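/- Let $(M_1^{n_1},g_1)$ and $(M_2^{n_2},g_2)$ be connected smooth Riemannian manifolds and let $(M,g)=(M_1\times M_2,\ g_1\oplus g_2)$ be their Riemannian product. Let $\nabla$ be a smooth connection on $TM$ that is metric ($\nabla g=0$) and flat (its curvature vanishes), and suppose that its torsion $$T(X,Y,Z)=g(\nabla_XY-\nabla_YX-[X,Y],Z)$$ is totally skew-symmetric, i.e. $T\in\Lambda^3(M)$ is a $3$-form. Then there are $3$-forms $T_1\in\Lambda^3(M_1)$ and $T_2\in\Lambda^3(M_2)$ such that $$T=\mathrm{pr}_1^*T_1+\mathrm{pr}_2^*T_2 ,$$ where $\mathrm{pr}_i:M\to M_i$ are the projections. Moreover, the connection splits: there are smooth flat metric connections $\nabla^1$ on $(M_1,g_1)$ and $\nabla^2$ on $(M_2,g_2)$, with torsion $3$-forms $T_1$ and $T_2$ respectively, such that $(M,g,\nabla)=(M_1,g_1,\nabla^1)\times(M_2,g_2,\nabla^2)$; that is, for all vector fields $Y_1$ on $M_1$ and $Y_2$ on $M_2$ and every tangent vector $(v_1,v_2)$ of $M_1\times M_2$, $$\nabla_{(v_1,v_2)}(Y_1,Y_2)=\big(\nabla^1_{v_1}Y_1,\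 \nabla^2_{v_2}Y_2\big).$$ -/

import Mathlib

open Bundle VectorField
open scoped Manifold ContDiff

noncomputable section

section SingleManifold

variable {E : Type*} [NormedAddCommGroup E] [NormedSpace ℝ E]
  {H : Type*} [TopologicalSpace H] (I : ModelWithCorners ℝ E H)
  (M : Type*) [TopologicalSpace M] [ChartedSpace H M] [IsManifold I ∞ M]

/-- A smooth differential `3`-form on `M`: an alternating trilinear form on every tangent space
such that the evaluation on any three smooth vector fields is a smooth function. -/
structure ThreeForm where
  toFun : ∀ x : M, TangentSpace I x [⋀^Fin 3]→L[ℝ] ℝ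
  smooth' : ∀ X : Fin 3 → ∀ x : M, TangentSpace I x,
    (∀ i, ContMDiff I I.tangent ∞ fun x ↦ (⟨x, X i x⟩ : TangentBundle I M)) →
      ContMDiff I 𝓘(ℝ, ℝ) ∞ fun x ↦ toFun x fun i ↦ X i x

variable {I M}

/-- The curvature `R(X, Y)Z = ∇_X ∇_Y Z - ∇_Y ∇_X Z - ∇_{[X, Y]} Z` of a connection on `TM`;
recall that `∇ Z x v` is the covariant derivative of `Z` at `x` in the direction `v`. -/
def connectionCurvature (nabla : CovariantDerivative I E (TangentSpace I : M → Type _))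
    (X Y Z : ∀ x : M, TangentSpace I x) (x : M) : TangentSpace I x :=
  nabla (fun y ↦ nabla Z y (Y y)) x (X x) - nabla (fun y ↦ nabla Z y (X y)) x (Y x)
    - nabla Z x (mlieBracket I X Y x)

/-- A connection is flat if its curvature vanishes on all smooth vector fields. -/
def IsFlatConnection (nabla : CovariantDerivative I E (TangentSpace I : M → Type _)) : Prop :=
  ∀ X Y Z : ∀ x : M, TangentSpace I x,
    ContMDiff I I.tangent ∞ (fun x ↦ (⟨x, X x⟩ : TangentBundle I M)) →
    ContMDiff I I.tangent ∞ (fun x ↦ (⟨x, Y x⟩ : TangentBundle I M)) →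
    ContMDiff I I.tangent ∞ (fun x ↦ (⟨x, Z x⟩ : TangentBundle I M)) →
    ∀ x, connectionCurvature nabla X Y Z x = 0

variable [FiniteDimensional ℝ E]
  [RiemannianBundle (fun x : M ↦ TangentSpace I x)]
  [IsContMDiffRiemannianBundle I ∞ E (fun x : M ↦ TangentSpace I x)]

/-- `nabla` is a smooth flat connection on `TM`, compatible with the Riemannian metric of `M`. -/
structure IsFlatMetricConnection
    (nabla : CovariantDerivative I E (TangentSpace I : M → Type _)) : Prop where
  smooth : CovariantDerivative.ContMDiffCovariantDerivative nabla ∞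
  metric : CovariantDerivative.IsMetricCompatible (V := fun x : M ↦ TangentSpace I x) nabla
  flat : IsFlatConnection nabla

/-- The torsion of `nabla`, viewed as the `(3,0)`-tensor `g(T(X, Y), Z)`, is the `3`-form `T`. -/
def HasTorsionForm (nabla : CovariantDerivative I E (TangentSpace I : M → Type _))
    (T : ThreeForm I M) : Prop :=
  ∀ (x : M) (X Y Z : TangentSpace I x),
    T.toFun x ![X, Y, Z] = inner ℝ (nabla.torsion x X Y) Z

end SingleManifold

section Product

variable {E₁ : Type*} [NormedAddCommGroup E₁] [NormedSpace ℝ E₁]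
  {H₁ : Type*} [TopologicalSpace H₁] {I₁ : ModelWithCorners ℝ E₁ H₁}
  {M₁ : Type*} [TopologicalSpace M₁] [ChartedSpace H₁ M₁] [IsManifold I₁ ∞ M₁]
  {E₂ : Type*} [NormedAddCommGroup E₂] [NormedSpace ℝ E₂]
  {H₂ : Type*} [TopologicalSpace H₂] {I₂ : ModelWithCorners ℝ E₂ H₂}
  {M₂ : Type*} [TopologicalSpace M₂] [ChartedSpace H₂ M₂] [IsManifold I₂ ∞ M₂]

variable (I₁ I₂) in
/-- The differential of the first projection of a product manifold. -/
def tangentFst (p : M₁ × M₂) : TangentSpace (I₁.prod I₂) p →L[ℝ] TangentSpace I₁ p.1 :=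
  mfderiv (I₁.prod I₂) I₁ Prod.fst p

variable (I₁ I₂) in
/-- The differential of the second projection of a product manifold. -/
def tangentSnd (p : M₁ × M₂) : TangentSpace (I₁.prod I₂) p →L[ℝ] TangentSpace I₂ p.2 :=
  mfderiv (I₁.prod I₂) I₂ Prod.snd p

variable (I₁ M₁ I₂ M₂) in
/-- The metric `g` of the product manifold is the Riemannian product of the metrics of the
factors: `g = pr₁^* g₁ + pr₂^* g₂`. -/
def IsRiemannianProduct [RiemannianBundle (fun x : M₁ ↦ TangentSpace I₁ x)]
    [RiemannianBundle (fun x : M₂ ↦ TangentSpace I₂ x)]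
    [RiemannianBundle (fun p : M₁ × M₂ ↦ TangentSpace (I₁.prod I₂) p)] : Prop :=
  ∀ (p : M₁ × M₂) (v w : TangentSpace (I₁.prod I₂) p),
    inner ℝ v w = inner ℝ (tangentFst I₁ I₂ p v) (tangentFst I₁ I₂ p w)
      + inner ℝ (tangentSnd I₁ I₂ p v) (tangentSnd I₁ I₂ p w)

/-- `T = T₁ + T₂`, where the forms `T₁` and `T₂` on the factors are regarded as forms on the
product manifold through pull-back by the projections. -/
def ThreeForm.IsSum (T : ThreeForm (I₁.prod I₂) (M₁ × M₂)) (T₁ : ThreeForm I₁ M₁)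
    (T₂ : ThreeForm I₂ M₂) : Prop :=
  ∀ p : M₁ × M₂, T.toFun p =
    (T₁.toFun p.1).compContinuousLinearMap (tangentFst I₁ I₂ p)
      + (T₂.toFun p.2).compContinuousLinearMap (tangentSnd I₁ I₂ p)

/-- The vector field `(x₁, x₂) ↦ (Y₁ x₁, Y₂ x₂)` on the product manifold. -/
def prodVectorField (Y₁ : ∀ x : M₁, TangentSpace I₁ x) (Y₂ : ∀ x : M₂, TangentSpace I₂ x) :
    ∀ p : M₁ × M₂, TangentSpace (I₁.prod I₂) p :=
  fun p ↦ ((Y₁ p.1, Y₂ p.2) : E₁ × E₂)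

/-- `nabla` is the product of the connections `nabla₁` and `nabla₂`, that is, the connection
`pr₁^* ∇¹ ⊕ pr₂^* ∇²` on `T(M₁ × M₂) = pr₁^* TM₁ ⊕ pr₂^* TM₂`: for vector fields `Y₁`, `Y₂` on the
factors and `v = (v₁, v₂)`, one has `∇_v (Y₁, Y₂) = (∇¹_{v₁} Y₁, ∇²_{v₂} Y₂)`. As every vector
field on the product is locally a combination, with functions as coefficients, of such fields,
this determines `nabla`. -/
def IsProductConnection
    (nabla : CovariantDerivative (I₁.prod I₂) (E₁ × E₂)
      (TangentSpace (I₁.prod I₂) : M₁ × M₂ → Type _))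
    (nabla₁ : CovariantDerivative I₁ E₁ (TangentSpace I₁ : M₁ → Type _))
    (nabla₂ : CovariantDerivative I₂ E₂ (TangentSpace I₂ : M₂ → Type _)) : Prop :=
  ∀ (Y₁ : ∀ x : M₁, TangentSpace I₁ x) (Y₂ : ∀ x : M₂, TangentSpace I₂ x) (p : M₁ × M₂),
    MDifferentiableAt I₁ I₁.tangent (fun x ↦ (⟨x, Y₁ x⟩ : TangentBundle I₁ M₁)) p.1 →
    MDifferentiableAt I₂ I₂.tangent (fun x ↦ (⟨x, Y₂ x⟩ : TangentBundle I₂ M₂)) p.2 →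
    ∀ v : TangentSpace (I₁.prod I₂) p,
      tangentFst I₁ I₂ p (nabla (prodVectorField Y₁ Y₂) p v)
          = nabla₁ Y₁ p.1 (tangentFst I₁ I₂ p v) ∧
        tangentSnd I₁ I₂ p (nabla (prodVectorField Y₁ Y₂) p v)
          = nabla₂ Y₂ p.2 (tangentSnd I₁ I₂ p v)

end Product

end

/-!
Write `X, Y, V` for vector fields on `M₁` and `A, C` for vector fields on `M₂`, each lifted to the
product `M₁ × M₂` as `prodVectorField X 0`, respectively `prodVectorField 0 A`. Lifts of fields
from different factors commute and are orthogonal (`mlieBracket_prodVectorField`,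
`IsRiemannianProduct.inner_prodVectorField`).

For a metric connection with totally skew torsion `T`, the Koszul formula reads
`2 ⟨∇_X Y, Z⟩ = koszul X Y Z + T(X, Y, Z)`, and the Koszul expression of the product metric is the
sum of those of the factors. Its part along a factor on which one of the first two fields vanishes
is zero, so that `2 ∇_A X = T(A, X)` and `2 ∇_X A = T(X, A)` (`two_smul_nabla_inr_inl`,
`two_smul_nabla_inl_inr`). As `∇_X X` is tangent to `M₁`, `∇_A A` is tangent to `M₂`, and
`⟨∇_X A, X⟩ = 0`, metricity gives
`⟨R(X, A) A, X⟩ = ⟨∇_X ∇_A A, X⟩ - ⟨∇_A ∇_X A, X⟩ = 0 - ¼ ‖T(X, A)‖²`.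
Flatness therefore forces the mixed torsion `T(X, A)` to vanish (`torsion_inl_inr_eq_zero`), and
with it `∇_A X` and `∇_X A`. By metricity `∇_V X` is then tangent to `M₁`, and it does not depend
on the point of `M₂`: for `C` on `M₂`, `∇_C ∇_V X = R(C, V) X + ∇_V ∇_C X = 0`, and `M₂` is
connected (`sliceFst_eq_sliceFst`).

Hence the restrictions of `∇` to a slice of each kind through one base point
(`CovariantDerivative.sliceFst`, `CovariantDerivative.sliceSnd`) are connections on the factors
whose product is `∇` (`isProductConnection_slice`). Smoothness, metricity and flatness pass from
the product to the factors, and the torsion of a product connection is the sum of the torsions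
of the factors.
-/

noncomputable section SplitConnection

open Set Filter Topology

/-! ### Smooth sections and functions with vanishing derivative -/

section ManifoldPreliminaries

variable {E : Type*} [NormedAddCommGroup E] [NormedSpace ℝ E]
  {H : Type*} [TopologicalSpace H] {I : ModelWithCorners ℝ E H}
  {M : Type*} [TopologicalSpace M] [ChartedSpace H M]

section Extension

variable [FiniteDimensional ℝ E] [T2Space M] [IsManifold I ∞ M]
  {F : Type*} [NormedAddCommGroup F] [NormedSpace ℝ F]
  {V : M → Type*} [TopologicalSpace (TotalSpace F V)]
  [∀ x, AddCommGroup (V x)] [∀ x, Module ℝ (V x)] [∀ x, TopologicalSpace (V x)]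
  [FiberBundle F V] [VectorBundle ℝ F V]

/-- Multiplication with a bump function: a smooth local section agrees near the point with a smooth
global one. -/
theorem exists_contMDiff_section_eventuallyEq {σ : Π x : M, V x} {u : Set M} {x : M}
    (hu : u ∈ 𝓝 x) (hσ : CMDiff[u] ∞ (T% σ)) :
    ∃ τ : Π x : M, V x, CMDiff ∞ (T% τ) ∧ ∀ᶠ y in 𝓝 x, τ y = σ y := by
  obtain ⟨f, -, hf⟩ := (SmoothBumpFunction.nhds_basis_tsupport (I := I) x).mem_iff.1
    (interior_mem_nhds.2 hu)
  refine ⟨fun y ↦ f y • σ y, ?_, ?_⟩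
  · exact ContMDiffOn.smul_section_of_tsupport (f.contMDiff.contMDiffOn) isOpen_interior hf
      (hσ.mono interior_subset)
  · filter_upwards [f.eventuallyEq_one] with y hy
    simp [hy]

variable (I) in
theorem exists_contMDiff_section_eq [ContMDiffVectorBundle ∞ F V I] {x : M} (v : V x) :
    ∃ τ : Π x : M, V x, CMDiff ∞ (T% τ) ∧ τ x = v := by
  obtain ⟨s, hs, hsσ⟩ := FiberBundle.exists_contMDiffOn_extend (k := ∞) I F v
  obtain ⟨τ, hτ, h⟩ := exists_contMDiff_section_eventuallyEq hs hsσ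
  exact ⟨τ, hτ, by simpa using h.self_of_nhds⟩

end Extension

/-- A family of linear maps on a finite-dimensional space is smooth if it is so pointwise: it is a
fixed linear combination of its values on a basis. -/
theorem contMDiffAt_clm_of_apply {F G : Type*} [NormedAddCommGroup F] [NormedSpace ℝ F]
    [FiniteDimensional ℝ F] [NormedAddCommGroup G] [NormedSpace ℝ G] {n : ℕ∞ω}
    {f : M → F →L[ℝ] G} {x : M} (hf : ∀ v, CMDiffAt n (fun y ↦ f y v) x) : CMDiffAt n f x := by
  let b := Module.finBasis ℝ F
  have h : f = fun y ↦ ∑ i, ContinuousLinearMap.smulRightL ℝ F G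
      (LinearMap.toContinuousLinearMap (b.coord i)) (f y (b i)) := by
    ext y v
    nth_rw 1 [← b.sum_repr v]
    simp only [map_sum, map_smul]
    simp
  rw [h]
  refine contMDiffAt_finsetSum fun i _ ↦ ?_
  exact (ContinuousLinearMap.contMDiff _).contMDiffAt.comp x (hf (b i))

/-- Smoothness of a family `A` of fibrewise linear maps can be tested on global smooth sections:
the columns of `A` in local trivializations are its values on local frames, and these agree near
a point with global sections. -/
theorem contMDiff_hom_section_of_apply [FiniteDimensional ℝ E] [T2Space M] [IsManifold I ∞ M]
    {F₁ F₂ : Type*} [NormedAddCommGroup F₁] [NormedSpace ℝ F₁] [FiniteDimensional ℝ F₁]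
    [NormedAddCommGroup F₂] [NormedSpace ℝ F₂]
    {V : M → Type*} [TopologicalSpace (TotalSpace F₁ V)]
    [∀ x, AddCommGroup (V x)] [∀ x, Module ℝ (V x)] [∀ x, TopologicalSpace (V x)]
    [FiberBundle F₁ V] [VectorBundle ℝ F₁ V] [ContMDiffVectorBundle ∞ F₁ V I]
    {W : M → Type*} [TopologicalSpace (TotalSpace F₂ W)]
    [∀ x, AddCommGroup (W x)] [∀ x, Module ℝ (W x)] [∀ x, TopologicalSpace (W x)]
    [∀ x, IsTopologicalAddGroup (W x)] [∀ x, ContinuousSMul ℝ (W x)]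
    [FiberBundle F₂ W] [VectorBundle ℝ F₂ W] [ContMDiffVectorBundle ∞ F₂ W I]
    {A : Π x : M, V x →L[ℝ] W x}
    (hA : ∀ σ : Π x : M, V x, CMDiff ∞ (T% σ) → CMDiff ∞ (T% (fun x ↦ A x (σ x)))) :
    ContMDiff I (I.prod 𝓘(ℝ, F₁ →L[ℝ] F₂)) ∞
      (fun x ↦ (⟨x, A x⟩ : TotalSpace (F₁ →L[ℝ] F₂) fun x ↦ V x →L[ℝ] W x)) := by
  intro x₀
  rw [contMDiffAt_hom_bundle]
  refine ⟨contMDiffAt_id, contMDiffAt_clm_of_apply fun v ↦ ?_⟩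
  set e₁ := trivializationAt F₁ V x₀
  set e₂ := trivializationAt F₂ W x₀
  have hx₁ : e₁.baseSet ∈ 𝓝 x₀ :=
    e₁.open_baseSet.mem_nhds (FiberBundle.mem_baseSet_trivializationAt' x₀)
  have hx₂ : e₂.baseSet ∈ 𝓝 x₀ :=
    e₂.open_baseSet.mem_nhds (FiberBundle.mem_baseSet_trivializationAt' x₀)
  have hs : CMDiff[e₁.baseSet] ∞ (T% (fun x ↦ e₁.symm x v)) := by
    intro x hx
    rw [e₁.contMDiffWithinAt_section _ hx]
    exact (contMDiffWithinAt_const (c := v)).congr (fun y hy ↦ by simp [hy]) (by simp [hx])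
  obtain ⟨τ, hτ, hτe⟩ := exists_contMDiff_section_eventuallyEq hx₁ hs
  have h := (contMDiffAt_section _).1 (hA τ hτ x₀)
  refine h.congr_of_eventuallyEq ?_
  filter_upwards [hx₁, hx₂, hτe] with y h₁ h₂ hy
  rw [ContinuousLinearMap.inCoordinates_eq h₁ h₂]
  simp [hy, e₁, e₂]

/-- A function with vanishing differential on a connected manifold without boundary is constant.
In a chart this is the corresponding fact on a ball of the model space, so the function is locally
constant. -/
theorem eq_of_mvfderiv_eq_zero [I.Boundaryless] [ConnectedSpace M] [IsManifold I 1 M]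
    {F : Type*} [NormedAddCommGroup F] [NormedSpace ℝ F] {f : M → F} (hf : MDiff f)
    (hf' : ∀ x (v : TangentSpace I x), (d% f x) v = 0) (x y : M) : f x = f y := by
  have : IsLocallyConstant f := by
    rw [IsLocallyConstant.iff_eventually_eq]
    intro x
    obtain ⟨r, hr, hball⟩ := Metric.isOpen_iff.1 (isOpen_extChartAt_target (I := I) x)
      (extChartAt I x x) (mem_extChartAt_target x)
    -- `I` is boundaryless, so the target of the chart is open and contains a ball
    have hd : ∀ z ∈ Metric.ball (extChartAt I x x) r,
        HasFDerivAt (f ∘ (extChartAt I x).symm) (0 : E →L[ℝ] F) z := by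
      intro z hz
      have h₁ : HasMFDerivAt I 𝓘(ℝ, F) f ((extChartAt I x).symm z) 0 := by
        have h₀ : mfderiv I 𝓘(ℝ, F) f ((extChartAt I x).symm z) = 0 := by
          ext v
          exact hf' _ v
        exact h₀ ▸ (hf _).hasMFDerivAt
      have h₂ : MDifferentiableAt 𝓘(ℝ, E) I (extChartAt I x).symm z :=
        ((contMDiffOn_extChartAt_symm (n := 1) x).contMDiffAt
          ((isOpen_extChartAt_target x).mem_nhds (hball hz))).mdifferentiableAt one_ne_zero
      have h₃ := h₁.comp z h₂.hasMFDerivAt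
      rw [ContinuousLinearMap.zero_comp] at h₃
      exact h₃.hasFDerivAt
    have hconst : ∀ z ∈ Metric.ball (extChartAt I x x) r,
        (f ∘ (extChartAt I x).symm) z = (f ∘ (extChartAt I x).symm) (extChartAt I x x) :=
      fun z hz ↦ Metric.isOpen_ball.is_const_of_fderiv_eq_zero
        (convex_ball (extChartAt I x x) r).isPreconnected
        (fun z hz ↦ (hd z hz).differentiableAt.differentiableWithinAt)
        (fun z hz ↦ (hd z hz).fderiv) hz (Metric.mem_ball_self hr)
    filter_upwards [(continuousAt_extChartAt (I := I) x).preimage_mem_nhds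
      (Metric.ball_mem_nhds _ hr),
      extChartAt_source_mem_nhds (I := I) x] with y hy hy'
    have h := hconst _ hy
    rwa [Function.comp_apply, Function.comp_apply, (extChartAt I x).left_inv hy',
      extChartAt_to_inv] at h
  exact this.apply_eq_of_isPreconnected isPreconnected_univ (mem_univ _) (mem_univ _)

end ManifoldPreliminaries

/-! ### Vector fields on a product manifold -/

section ProductFields

variable {E₁ : Type*} [NormedAddCommGroup E₁] [NormedSpace ℝ E₁]
  {H₁ : Type*} [TopologicalSpace H₁] {I₁ : ModelWithCorners ℝ E₁ H₁}
  {M₁ : Type*} [TopologicalSpace M₁] [ChartedSpace H₁ M₁]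
  {E₂ : Type*} [NormedAddCommGroup E₂] [NormedSpace ℝ E₂]
  {H₂ : Type*} [TopologicalSpace H₂] {I₂ : ModelWithCorners ℝ E₂ H₂}
  {M₂ : Type*} [TopologicalSpace M₂] [ChartedSpace H₂ M₂]

theorem tangentFst_apply {p : M₁ × M₂} (v : TangentSpace (I₁.prod I₂) p) :
    tangentFst I₁ I₂ p v = (v : E₁ × E₂).1 := by
  rw [tangentFst, mfderiv_fst]
  rfl

theorem tangentSnd_apply {p : M₁ × M₂} (v : TangentSpace (I₁.prod I₂) p) :
    tangentSnd I₁ I₂ p v = (v : E₁ × E₂).2 := by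
  rw [tangentSnd, mfderiv_snd]
  rfl

section smoothness

variable [IsManifold I₁ ∞ M₁] [IsManifold I₂ ∞ M₂]
  {X : Π x : M₁, TangentSpace I₁ x} {A : Π x : M₂, TangentSpace I₂ x} {p : M₁ × M₂}

theorem ContMDiffAt.prodVectorField {n : ℕ∞ω} (hX : CMDiffAt n (T% X) p.1)
    (hA : CMDiffAt n (T% A) p.2) : CMDiffAt n (T% (prodVectorField X A)) p :=
  (contMDiff_equivTangentBundleProd_symm (I := I₁) (I' := I₂) (M := M₁) (M' := M₂)).contMDiffAt.comp
    p ((hX.comp p contMDiffAt_fst).prodMk (hA.comp p contMDiffAt_snd))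

theorem ContMDiff.prodVectorField {n : ℕ∞ω} (hX : CMDiff n (T% X))
    (hA : CMDiff n (T% A)) : CMDiff n (T% (prodVectorField X A)) :=
  fun _ ↦ (hX _).prodVectorField (hA _)

theorem MDifferentiableAt.prodVectorField (hX : MDiffAt (T% X) p.1)
    (hA : MDiffAt (T% A) p.2) : MDiffAt (T% (prodVectorField X A)) p :=
  ((contMDiff_equivTangentBundleProd_symm (n := 1) (I := I₁) (I' := I₂) (M := M₁)
    (M' := M₂)).mdifferentiable one_ne_zero _).comp
    p ((hX.comp p mdifferentiableAt_fst).prodMk (hA.comp p mdifferentiableAt_snd))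

end smoothness

theorem ContinuousLinearMap.inverse_prodMap_apply {F₁ F₂ G₁ G₂ : Type*}
    [AddCommGroup F₁] [Module ℝ F₁] [TopologicalSpace F₁]
    [AddCommGroup F₂] [Module ℝ F₂] [TopologicalSpace F₂]
    [AddCommGroup G₁] [Module ℝ G₁] [TopologicalSpace G₁]
    [AddCommGroup G₂] [Module ℝ G₂] [TopologicalSpace G₂]
    {f : F₁ →L[ℝ] G₁} {g : F₂ →L[ℝ] G₂} (hf : f.IsInvertible) (hg : g.IsInvertible)
    (v : G₁ × G₂) : (f.prodMap g).inverse v = (f.inverse v.1, g.inverse v.2) := by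
  obtain ⟨e, rfl⟩ := hf
  obtain ⟨e', rfl⟩ := hg
  have : (e : F₁ →L[ℝ] G₁).prodMap (e' : F₂ →L[ℝ] G₂) = (e.prodCongr e' : _ →L[ℝ] _) := rfl
  rw [this, ContinuousLinearMap.inverse_equiv, ContinuousLinearMap.inverse_equiv,
    ContinuousLinearMap.inverse_equiv]
  rfl

/-- The Lie bracket of product vector fields in a product of normed spaces. -/
theorem lieBracketWithin_prod {V W : E₁ → E₁} {A B : E₂ → E₂} {s : Set E₁} {t : Set E₂}
    {y : E₁ × E₂}
    (hV : DifferentiableWithinAt ℝ V s y.1) (hW : DifferentiableWithinAt ℝ W s y.1)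
    (hA : DifferentiableWithinAt ℝ A t y.2) (hB : DifferentiableWithinAt ℝ B t y.2)
    (hs : UniqueDiffWithinAt ℝ s y.1) (ht : UniqueDiffWithinAt ℝ t y.2) :
    lieBracketWithin ℝ (fun z : E₁ × E₂ ↦ (V z.1, A z.2)) (fun z ↦ (W z.1, B z.2)) (s ×ˢ t) y =
      (lieBracketWithin ℝ V W s y.1, lieBracketWithin ℝ A B t y.2) := by
  have key : ∀ {V : E₁ → E₁} {A : E₂ → E₂}, DifferentiableWithinAt ℝ V s y.1 →
      DifferentiableWithinAt ℝ A t y.2 → ∀ w : E₁ × E₂,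
      fderivWithin ℝ (fun z : E₁ × E₂ ↦ (V z.1, A z.2)) (s ×ˢ t) y w =
        (fderivWithin ℝ V s y.1 w.1, fderivWithin ℝ A t y.2 w.2) := by
    intro V A hV hA w
    have h₁ : HasFDerivWithinAt (fun z : E₁ × E₂ ↦ V z.1) _ (s ×ˢ t) y :=
      hV.hasFDerivWithinAt.comp y hasFDerivWithinAt_fst (fun z hz ↦ hz.1)
    have h₂ : HasFDerivWithinAt (fun z : E₁ × E₂ ↦ A z.2) _ (s ×ˢ t) y :=
      hA.hasFDerivWithinAt.comp y hasFDerivWithinAt_snd (fun z hz ↦ hz.2)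
    rw [(h₁.prodMk h₂).fderivWithin (hs.prod ht)]
    rfl
  simp only [lieBracketWithin, key hV hA, key hW hB, Prod.mk_sub_mk]

theorem mfderiv_extChartAt_prod [IsManifold I₁ 1 M₁] [IsManifold I₂ 1 M₂] (p : M₁ × M₂) :
    mfderiv (I₁.prod I₂) 𝓘(ℝ, E₁ × E₂) (extChartAt (I₁.prod I₂) p) p =
      (mfderiv I₁ 𝓘(ℝ, E₁) (extChartAt I₁ p.1) p.1).prodMap
        (mfderiv I₂ 𝓘(ℝ, E₂) (extChartAt I₂ p.2) p.2) := by
  have h₁ := (mdifferentiableAt_extChartAt (I := I₁)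
    (mem_chart_source H₁ p.1)).hasMFDerivAt.comp p (hasMFDerivAt_fst (I := I₁) (I' := I₂) p)
  have h₂ := (mdifferentiableAt_extChartAt (I := I₂)
    (mem_chart_source H₂ p.2)).hasMFDerivAt.comp p (hasMFDerivAt_snd (I := I₁) (I' := I₂) p)
  rw [extChartAt_prod]
  have h : HasMFDerivAt (I₁.prod I₂) 𝓘(ℝ, E₁ × E₂)
    ((extChartAt I₁ p.1).prod (extChartAt I₂ p.2)) p _ := ⟨h₁.1.prodMk h₂.1, h₁.2.prodMk h₂.2⟩
  exact h.mfderiv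

theorem mfderivWithin_extChartAt_symm_prod [IsManifold I₁ 1 M₁] [IsManifold I₂ 1 M₂]
    (p : M₁ × M₂) {y : E₁ × E₂} (hy : y ∈ (extChartAt (I₁.prod I₂) p).target) :
    mfderivWithin 𝓘(ℝ, E₁ × E₂) (I₁.prod I₂) (extChartAt (I₁.prod I₂) p).symm
      (range (I₁.prod I₂)) y =
      (mfderivWithin 𝓘(ℝ, E₁) I₁ (extChartAt I₁ p.1).symm (range I₁) y.1).prodMap
        (mfderivWithin 𝓘(ℝ, E₂) I₂ (extChartAt I₂ p.2).symm (range I₂) y.2) := by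
  rw [extChartAt_prod] at hy
  rw [ModelWithCorners.range_prod, extChartAt_prod]
  have h₁ := ((mdifferentiableWithinAt_extChartAt_symm (I := I₁) hy.1).hasMFDerivWithinAt).comp y
    (s := range I₁ ×ˢ range I₂) (hasFDerivWithinAt_fst (𝕜 := ℝ) (p := y)).hasMFDerivWithinAt
    (fun z hz ↦ hz.1)
  have h₂ := ((mdifferentiableWithinAt_extChartAt_symm (I := I₂) hy.2).hasMFDerivWithinAt).comp y
    (s := range I₁ ×ˢ range I₂) (hasFDerivWithinAt_snd (𝕜 := ℝ) (p := y)).hasMFDerivWithinAt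
    (fun z hz ↦ hz.2)
  have h : HasMFDerivWithinAt 𝓘(ℝ, E₁ × E₂) (I₁.prod I₂)
    ((extChartAt I₁ p.1).prod (extChartAt I₂ p.2)).symm (range I₁ ×ˢ range I₂) y _ := h₁.prodMk h₂
  refine h.mfderivWithin ?_
  exact ((I₁.uniqueDiffOn _ (extChartAt_target_subset_range p.1 hy.1)).prod
    (I₂.uniqueDiffOn _ (extChartAt_target_subset_range p.2 hy.2))).uniqueMDiffWithinAt

theorem mpullbackWithin_extChartAt_symm_prodVectorField [IsManifold I₁ ∞ M₁] [IsManifold I₂ ∞ M₂]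
    (X : Π x : M₁, TangentSpace I₁ x) (A : Π x : M₂, TangentSpace I₂ x)
    (p : M₁ × M₂) {y : E₁ × E₂} (hy : y ∈ (extChartAt (I₁.prod I₂) p).target) :
    mpullbackWithin 𝓘(ℝ, E₁ × E₂) (I₁.prod I₂) (extChartAt (I₁.prod I₂) p).symm
      (prodVectorField X A) (range (I₁.prod I₂)) y =
    (mpullbackWithin 𝓘(ℝ, E₁) I₁ (extChartAt I₁ p.1).symm X (range I₁) y.1,
      mpullbackWithin 𝓘(ℝ, E₂) I₂ (extChartAt I₂ p.2).symm A (range I₂) y.2) := by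
  rw [mpullbackWithin_apply, mfderivWithin_extChartAt_symm_prod p hy]
  rw [extChartAt_prod] at hy ⊢
  exact ContinuousLinearMap.inverse_prodMap_apply
    (isInvertible_mfderivWithin_extChartAt_symm hy.1)
    (isInvertible_mfderivWithin_extChartAt_symm hy.2) _

/-- The Lie bracket of product vector fields is taken factor by factor. The bracket is defined by
pulling back to the model space by the extended charts, and those of the product are products
of charts. -/
theorem mlieBracket_prodVectorField [CompleteSpace E₁] [CompleteSpace E₂]
    [IsManifold I₁ ∞ M₁] [IsManifold I₂ ∞ M₂]
    {X Y : Π x : M₁, TangentSpace I₁ x} {A B : Π x : M₂, TangentSpace I₂ x} {p : M₁ × M₂}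
    (hX : MDiffAt (T% X) p.1) (hY : MDiffAt (T% Y) p.1)
    (hA : MDiffAt (T% A) p.2) (hB : MDiffAt (T% B) p.2) :
    mlieBracket (I₁.prod I₂) (prodVectorField X A) (prodVectorField Y B) p =
      prodVectorField (mlieBracket I₁ X Y) (mlieBracket I₂ A B) p := by
  have key : ∀ {X : Π x : M₁, TangentSpace I₁ x}, MDiffAt (T% X) p.1 →
      DifferentiableWithinAt ℝ
        (mpullbackWithin 𝓘(ℝ, E₁) I₁ (extChartAt I₁ p.1).symm X (range I₁)) (range I₁)
        (extChartAt I₁ p.1 p.1) := fun h ↦ by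
    simpa using MDifferentiableWithinAt.differentiableWithinAt_mpullbackWithin_vectorField
      (mdifferentiableWithinAt_univ.2 h)
  have key' : ∀ {A : Π x : M₂, TangentSpace I₂ x}, MDiffAt (T% A) p.2 →
      DifferentiableWithinAt ℝ
        (mpullbackWithin 𝓘(ℝ, E₂) I₂ (extChartAt I₂ p.2).symm A (range I₂)) (range I₂)
        (extChartAt I₂ p.2 p.2) := fun h ↦ by
    simpa using MDifferentiableWithinAt.differentiableWithinAt_mpullbackWithin_vectorField
      (mdifferentiableWithinAt_univ.2 h)
  have hev : ∀ (X : Π x : M₁, TangentSpace I₁ x) (A : Π x : M₂, TangentSpace I₂ x),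
      mpullbackWithin 𝓘(ℝ, E₁ × E₂) (I₁.prod I₂) (extChartAt (I₁.prod I₂) p).symm
        (prodVectorField X A) (range (I₁.prod I₂)) =ᶠ[𝓝[range (I₁.prod I₂)]
          (extChartAt (I₁.prod I₂) p p)]
      fun y ↦ (mpullbackWithin 𝓘(ℝ, E₁) I₁ (extChartAt I₁ p.1).symm X (range I₁) y.1,
        mpullbackWithin 𝓘(ℝ, E₂) I₂ (extChartAt I₂ p.2).symm A (range I₂) y.2) := by
    intro X A
    filter_upwards [extChartAt_target_mem_nhdsWithin (I := I₁.prod I₂) p] with y hy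
    exact mpullbackWithin_extChartAt_symm_prodVectorField X A p hy
  have hp : extChartAt (I₁.prod I₂) p p = (extChartAt I₁ p.1 p.1, extChartAt I₂ p.2 p.2) := by
    rw [extChartAt_prod]
    rfl
  have hR := lieBracketWithin_prod (y := (extChartAt I₁ p.1 p.1, extChartAt I₂ p.2 p.2))
    (key hX) (key hY) (key' hA) (key' hB)
    (I₁.uniqueDiffOn _ (mem_range_self _)) (I₂.uniqueDiffOn _ (mem_range_self _))
  rw [← hp, ← ModelWithCorners.range_prod] at hR
  have hL := ((hev X A).lieBracketWithin_vectorField_eq (𝕜 := ℝ)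
    (mpullbackWithin_extChartAt_symm_prodVectorField X A p (mem_extChartAt_target p))
    (hev Y B) (mpullbackWithin_extChartAt_symm_prodVectorField Y B p
      (mem_extChartAt_target p))).trans hR
  simp only [prodVectorField, ← mlieBracketWithin_univ, mlieBracketWithin_apply, preimage_univ,
    univ_inter] at hL ⊢
  rw [hL, mfderiv_extChartAt_prod]
  exact ContinuousLinearMap.inverse_prodMap_apply
    (isInvertible_mfderiv_extChartAt (mem_extChartAt_source p.1))
    (isInvertible_mfderiv_extChartAt (mem_extChartAt_source p.2)) _

end ProductFields

/-! ### The Koszul formula with skew torsion -/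

section Koszul

variable {E : Type*} [NormedAddCommGroup E] [NormedSpace ℝ E]
  {H : Type*} [TopologicalSpace H] (I : ModelWithCorners ℝ E H)
  {M : Type*} [TopologicalSpace M] [ChartedSpace H M]
  [RiemannianBundle (fun x : M ↦ TangentSpace I x)]

/-- The right-hand side of the Koszul formula `2 ⟨∇_X Y, Z⟩ = …` for the Levi-Civita connection,
evaluated at the point `x`. -/
def koszul (X Y Z : Π x : M, TangentSpace I x) (x : M) : ℝ :=
  (d% (fun y ↦ inner ℝ (Y y) (Z y)) x) (X x) + (d% (fun y ↦ inner ℝ (X y) (Z y)) x) (Y x)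
    - (d% (fun y ↦ inner ℝ (X y) (Y y)) x) (Z x) + inner ℝ (mlieBracket I X Y x) (Z x)
    - inner ℝ (mlieBracket I X Z x) (Y x) - inner ℝ (mlieBracket I Y Z x) (X x)

variable {I}
variable (X Y Z : Π x : M, TangentSpace I x) (x : M)

@[simp]
theorem koszul_zero_left : koszul I 0 Y Z x = 0 := by
  simp [koszul, mvfderiv_const]

@[simp]
theorem koszul_zero_middle : koszul I X 0 Z x = 0 := by
  simp [koszul, mvfderiv_const]

@[simp]
theorem koszul_zero_right : koszul I X Y 0 x = 0 := by
  simp [koszul, mvfderiv_const]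

variable {X Y Z x}

theorem MDifferentiableAt.inner_vectorField [IsManifold I 1 M]
    [IsContMDiffRiemannianBundle I 1 E (fun x : M ↦ TangentSpace I x)]
    (hX : MDiffAt (T% X) x) (hY : MDiffAt (T% Y) x) :
    MDiffAt (fun y ↦ inner ℝ (X y) (Y y)) x :=
  MDifferentiableAt.inner_bundle (E := fun x : M ↦ TangentSpace I x) (b := id) hX hY

/-- The Koszul formula for a metric connection with totally skew-symmetric torsion `T`. -/
theorem two_mul_inner_eq_koszul_add_torsion [FiniteDimensional ℝ E] [IsManifold I ∞ M]
    [IsContMDiffRiemannianBundle I ∞ E (fun x : M ↦ TangentSpace I x)]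
    {nabla : CovariantDerivative I E (TangentSpace I : M → Type _)}
    (hg : CovariantDerivative.IsMetricCompatible (V := fun x : M ↦ TangentSpace I x) nabla)
    {T : ThreeForm I M} (hT : HasTorsionForm nabla T)
    (hX : MDiffAt (T% X) x) (hY : MDiffAt (T% Y) x) (hZ : MDiffAt (T% Z) x) :
    2 * inner ℝ (nabla Y x (X x)) (Z x) = koszul I X Y Z x + T.toFun x ![X x, Y x, Z x] := by
  have : CompleteSpace E := FiniteDimensional.complete ℝ E
  -- the Koszul computation: metricity and the torsion are each used once per pair of fields
  have tor : ∀ {U V : Π x : M, TangentSpace I x}, MDiffAt (T% U) x → MDiffAt (T% V) x →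
      ∀ w, T.toFun x ![U x, V x, w] = inner ℝ (nabla V x (U x)) w - inner ℝ (nabla U x (V x)) w
        - inner ℝ (mlieBracket I U V x) w := fun hU hV w ↦ by
    rw [hT, nabla.torsion_apply hU hV, inner_sub_left, inner_sub_left]
  have swap₁₂ : ∀ u v w, T.toFun x ![u, v, w] = - T.toFun x ![v, u, w] := fun u v w ↦ by
    rw [hT, hT, nabla.torsion_antisymm, inner_neg_left]
  have swap₂₃ : ∀ u v w, T.toFun x ![u, v, w] = - T.toFun x ![u, w, v] := fun u v w ↦ by
    have h := (T.toFun x).toAlternatingMap.map_swap ![u, w, v] (i := 1) (j := 2) (by decide)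
    refine Eq.trans (congrArg (T.toFun x) ?_) h
    ext i
    fin_cases i <;> rfl
  have h₁ := hg.mvfderiv_inner_eq X hY hZ
  have h₂ := hg.mvfderiv_inner_eq Y hX hZ
  have h₃ := hg.mvfderiv_inner_eq Z hX hY
  have t₁ := tor hX hY (Z x)
  have t₂ := tor hX hZ (Y x)
  have t₃ := tor hY hZ (X x)
  rw [swap₂₃] at t₂
  rw [swap₂₃, swap₁₂] at t₃
  simp only [koszul, h₁, h₂, h₃]
  linarith [real_inner_comm (Y x) (nabla Z x (X x)), real_inner_comm (X x) (nabla Z x (Y x)),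
    real_inner_comm (X x) (nabla Y x (Z x))]

end Koszul

/-! ### The Koszul expression of a Riemannian product -/

section Product

variable {E₁ : Type*} [NormedAddCommGroup E₁] [NormedSpace ℝ E₁]
  {H₁ : Type*} [TopologicalSpace H₁] {I₁ : ModelWithCorners ℝ E₁ H₁}
  {M₁ : Type*} [TopologicalSpace M₁] [ChartedSpace H₁ M₁]
  {E₂ : Type*} [NormedAddCommGroup E₂] [NormedSpace ℝ E₂]
  {H₂ : Type*} [TopologicalSpace H₂] {I₂ : ModelWithCorners ℝ E₂ H₂}
  {M₂ : Type*} [TopologicalSpace M₂] [ChartedSpace H₂ M₂]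
  [RiemannianBundle (fun x : M₁ ↦ TangentSpace I₁ x)]
  [RiemannianBundle (fun x : M₂ ↦ TangentSpace I₂ x)]
  [RiemannianBundle (fun p : M₁ × M₂ ↦ TangentSpace (I₁.prod I₂) p)]

variable {X Y Z : Π x : M₁, TangentSpace I₁ x} {A B C : Π x : M₂, TangentSpace I₂ x}
  {p : M₁ × M₂}

theorem IsRiemannianProduct.inner_prodVectorField (hprod : IsRiemannianProduct I₁ M₁ I₂ M₂)
    (X Y : Π x : M₁, TangentSpace I₁ x) (A B : Π x : M₂, TangentSpace I₂ x) (p : M₁ × M₂) :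
    inner ℝ (prodVectorField X A p) (prodVectorField Y B p) =
      inner ℝ (X p.1) (Y p.1) + inner ℝ (A p.2) (B p.2) := by
  rw [hprod, tangentFst_apply, tangentFst_apply, tangentSnd_apply, tangentSnd_apply]
  rfl

variable [IsManifold I₁ ∞ M₁] [IsManifold I₂ ∞ M₂]
  [IsContMDiffRiemannianBundle I₁ ∞ E₁ (fun x : M₁ ↦ TangentSpace I₁ x)]
  [IsContMDiffRiemannianBundle I₂ ∞ E₂ (fun x : M₂ ↦ TangentSpace I₂ x)]

theorem IsRiemannianProduct.mvfderiv_inner (hprod : IsRiemannianProduct I₁ M₁ I₂ M₂)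
    (hX : MDiffAt (T% X) p.1) (hY : MDiffAt (T% Y) p.1)
    (hA : MDiffAt (T% A) p.2) (hB : MDiffAt (T% B) p.2) (v : TangentSpace (I₁.prod I₂) p) :
    (d% (fun q ↦ inner ℝ (prodVectorField X A q) (prodVectorField Y B q)) p) v =
      (d% (fun x ↦ inner ℝ (X x) (Y x)) p.1) (tangentFst I₁ I₂ p v) +
        (d% (fun x ↦ inner ℝ (A x) (B x)) p.2) (tangentSnd I₁ I₂ p v) := by
  have h₁ := hX.inner_vectorField hY
  have h₂ := hA.inner_vectorField hB
  simp_rw [hprod.inner_prodVectorField]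
  rw [mvfderiv_fun_add (g := fun q : M₁ × M₂ ↦ inner ℝ (X q.1) (Y q.1))
    (g' := fun q : M₁ × M₂ ↦ inner ℝ (A q.2) (B q.2))
    (h₁.comp p mdifferentiableAt_fst) (h₂.comp p mdifferentiableAt_snd)]
  have e₁ := mvfderiv_comp p h₁ (mdifferentiableAt_fst (I := I₁) (I' := I₂))
  have e₂ := mvfderiv_comp p h₂ (mdifferentiableAt_snd (I := I₁) (I' := I₂))
  exact congrArg₂ (· + ·) (congr($e₁ v)) (congr($e₂ v))

/-- The Koszul expression of a product metric is the sum of those of the factors. -/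
theorem IsRiemannianProduct.koszul_prodVectorField [CompleteSpace E₁] [CompleteSpace E₂]
    (hprod : IsRiemannianProduct I₁ M₁ I₂ M₂)
    (hX : MDiffAt (T% X) p.1) (hY : MDiffAt (T% Y) p.1) (hZ : MDiffAt (T% Z) p.1)
    (hA : MDiffAt (T% A) p.2) (hB : MDiffAt (T% B) p.2) (hC : MDiffAt (T% C) p.2) :
    koszul (I₁.prod I₂) (prodVectorField X A) (prodVectorField Y B) (prodVectorField Z C) p =
      koszul I₁ X Y Z p.1 + koszul I₂ A B C p.2 := by
  simp only [koszul, hprod.mvfderiv_inner, hX, hY, hZ, hA, hB, hC]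
  simp only [mlieBracket_prodVectorField, hX, hY, hZ, hA, hB, hC,
    hprod.inner_prodVectorField, tangentFst_apply, tangentSnd_apply]
  simp only [prodVectorField]
  ring

end Product

/-! ### The mixed torsion vanishes -/

theorem CovariantDerivative.contMDiff_apply {E : Type*} [NormedAddCommGroup E] [NormedSpace ℝ E]
    {H : Type*} [TopologicalSpace H] {I : ModelWithCorners ℝ E H}
    {M : Type*} [TopologicalSpace M] [ChartedSpace H M] [IsManifold I ∞ M]
    {nabla : CovariantDerivative I E (TangentSpace I : M → Type _)}
    (hs : CovariantDerivative.ContMDiffCovariantDerivative nabla ∞)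
    {X Y : Π x : M, TangentSpace I x} (hX : CMDiff ∞ (T% X)) (hY : CMDiff ∞ (T% Y)) :
    CMDiff ∞ (T% (fun x ↦ nabla Y x (X x))) := by
  have h := hs.contMDiff.contMDiff (σ := Y) hY.contMDiffOn
  rw [contMDiffOn_univ] at h
  exact ContMDiff.clm_bundle_apply h hX

section ZeroField

variable {E : Type*} [NormedAddCommGroup E] [NormedSpace ℝ E]
  {H : Type*} [TopologicalSpace H] {I : ModelWithCorners ℝ E H}
  {M : Type*} [TopologicalSpace M] [ChartedSpace H M] [IsManifold I ∞ M]

theorem contMDiff_zero_vectorField {n : ℕ∞ω} :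
    CMDiff n (T% (0 : Π x : M, TangentSpace I x)) :=
  fun _ ↦ contMDiff_zeroSection ..

theorem mdifferentiableAt_zero_vectorField {x : M} :
    MDiffAt (T% (0 : Π x : M, TangentSpace I x)) x :=
  mdifferentiableAt_zeroSection ..

end ZeroField

section Product

variable {E₁ : Type*} [NormedAddCommGroup E₁] [NormedSpace ℝ E₁]
  {H₁ : Type*} [TopologicalSpace H₁] {I₁ : ModelWithCorners ℝ E₁ H₁}
  {M₁ : Type*} [TopologicalSpace M₁] [ChartedSpace H₁ M₁]
  {E₂ : Type*} [NormedAddCommGroup E₂] [NormedSpace ℝ E₂]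
  {H₂ : Type*} [TopologicalSpace H₂] {I₂ : ModelWithCorners ℝ E₂ H₂}
  {M₂ : Type*} [TopologicalSpace M₂] [ChartedSpace H₂ M₂]

variable (I₁ I₂) in
/-- The inclusion of the tangent space of the first factor in that of the product, as the
vectors tangent to the slice `M₁ × {p.2}`. It uses that the fibres of the tangent bundle of the
product are by definition `E₁ × E₂`. -/
def tangentInl (p : M₁ × M₂) : TangentSpace I₁ p.1 →L[ℝ] TangentSpace (I₁.prod I₂) p :=
  ContinuousLinearMap.inl ℝ E₁ E₂

variable (I₁ I₂) in
/-- The inclusion of the tangent space of the second factor in that of the product, as the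
vectors tangent to the slice `{p.1} × M₂`. -/
def tangentInr (p : M₁ × M₂) : TangentSpace I₂ p.2 →L[ℝ] TangentSpace (I₁.prod I₂) p :=
  ContinuousLinearMap.inr ℝ E₁ E₂

section algebra

variable {p : M₁ × M₂}

@[simp]
theorem tangentFst_tangentInl (v : TangentSpace I₁ p.1) :
    tangentFst I₁ I₂ p (tangentInl I₁ I₂ p v) = v := by
  rw [tangentFst_apply]; rfl

@[simp]
theorem tangentSnd_tangentInl (v : TangentSpace I₁ p.1) :
    tangentSnd I₁ I₂ p (tangentInl I₁ I₂ p v) = 0 := by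
  rw [tangentSnd_apply]; rfl

@[simp]
theorem tangentFst_tangentInr (v : TangentSpace I₂ p.2) :
    tangentFst I₁ I₂ p (tangentInr I₁ I₂ p v) = 0 := by
  rw [tangentFst_apply]; rfl

@[simp]
theorem tangentSnd_tangentInr (v : TangentSpace I₂ p.2) :
    tangentSnd I₁ I₂ p (tangentInr I₁ I₂ p v) = v := by
  rw [tangentSnd_apply]; rfl

theorem tangentInl_add_tangentInr (v : TangentSpace (I₁.prod I₂) p) :
    tangentInl I₁ I₂ p (tangentFst I₁ I₂ p v) + tangentInr I₁ I₂ p (tangentSnd I₁ I₂ p v) = v := by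
  rw [tangentFst_apply, tangentSnd_apply]
  exact Prod.fst_add_snd (v : E₁ × E₂)

theorem prodVectorField_zero_right (X : Π x : M₁, TangentSpace I₁ x) :
    prodVectorField X (0 : Π x : M₂, TangentSpace I₂ x) p = tangentInl I₁ I₂ p (X p.1) := rfl

theorem prodVectorField_zero_left (A : Π x : M₂, TangentSpace I₂ x) :
    prodVectorField (0 : Π x : M₁, TangentSpace I₁ x) A p = tangentInr I₁ I₂ p (A p.2) := rfl

theorem prodVectorField_eq_add (X : Π x : M₁, TangentSpace I₁ x) (A : Π x : M₂, TangentSpace I₂ x) :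
    prodVectorField X A = prodVectorField X (0 : Π x : M₂, TangentSpace I₂ x) +
      prodVectorField (0 : Π x : M₁, TangentSpace I₁ x) A := by
  ext q
  exact (Prod.fst_add_snd ((X q.1, A q.2) : E₁ × E₂)).symm

theorem prodVectorField_apply (X : Π x : M₁, TangentSpace I₁ x) (A : Π x : M₂, TangentSpace I₂ x) :
    prodVectorField X A p = tangentInl I₁ I₂ p (X p.1) + tangentInr I₁ I₂ p (A p.2) :=
  (Prod.fst_add_snd ((X p.1, A p.2) : E₁ × E₂)).symm

theorem exists_prodVectorField_eq [IsManifold I₁ ∞ M₁] [IsManifold I₂ ∞ M₂]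
    (w : TangentSpace (I₁.prod I₂) p) :
    ∃ (Z : Π x : M₁, TangentSpace I₁ x) (C : Π x : M₂, TangentSpace I₂ x),
      MDiffAt (T% Z) p.1 ∧ MDiffAt (T% C) p.2 ∧ prodVectorField Z C p = w := by
  refine ⟨FiberBundle.extend E₁ (tangentFst I₁ I₂ p w),
    FiberBundle.extend E₂ (tangentSnd I₁ I₂ p w),
    FiberBundle.mdifferentiableAt_extend .., FiberBundle.mdifferentiableAt_extend .., ?_⟩
  rw [prodVectorField_apply, FiberBundle.extend_apply_self, FiberBundle.extend_apply_self,
    tangentInl_add_tangentInr]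

variable [RiemannianBundle (fun x : M₁ ↦ TangentSpace I₁ x)]
  [RiemannianBundle (fun x : M₂ ↦ TangentSpace I₂ x)]
  [RiemannianBundle (fun p : M₁ × M₂ ↦ TangentSpace (I₁.prod I₂) p)]

theorem IsRiemannianProduct.inner_tangentInl (hprod : IsRiemannianProduct I₁ M₁ I₂ M₂)
    (v : TangentSpace (I₁.prod I₂) p) (w : TangentSpace I₁ p.1) :
    inner ℝ v (tangentInl I₁ I₂ p w) = inner ℝ (tangentFst I₁ I₂ p v) w := by
  rw [hprod, tangentFst_tangentInl, tangentSnd_tangentInl, inner_zero_right, add_zero]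

theorem IsRiemannianProduct.inner_tangentInr (hprod : IsRiemannianProduct I₁ M₁ I₂ M₂)
    (v : TangentSpace (I₁.prod I₂) p) (w : TangentSpace I₂ p.2) :
    inner ℝ v (tangentInr I₁ I₂ p w) = inner ℝ (tangentSnd I₁ I₂ p v) w := by
  rw [hprod, tangentFst_tangentInr, tangentSnd_tangentInr, inner_zero_right, zero_add]

end algebra

variable [IsManifold I₁ ∞ M₁] [IsManifold I₂ ∞ M₂]

variable [RiemannianBundle (fun x : M₁ ↦ TangentSpace I₁ x)]
  [IsContMDiffRiemannianBundle I₁ ∞ E₁ (fun x : M₁ ↦ TangentSpace I₁ x)]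
  [RiemannianBundle (fun x : M₂ ↦ TangentSpace I₂ x)]
  [IsContMDiffRiemannianBundle I₂ ∞ E₂ (fun x : M₂ ↦ TangentSpace I₂ x)]
  [RiemannianBundle (fun p : M₁ × M₂ ↦ TangentSpace (I₁.prod I₂) p)]
  [IsContMDiffRiemannianBundle (I₁.prod I₂) ∞ (E₁ × E₂)
    (fun p : M₁ × M₂ ↦ TangentSpace (I₁.prod I₂) p)]
  [FiniteDimensional ℝ E₁] [FiniteDimensional ℝ E₂]
  {nabla : CovariantDerivative (I₁.prod I₂) (E₁ × E₂)
      (TangentSpace (I₁.prod I₂) : M₁ × M₂ → Type _)}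
  {T : ThreeForm (I₁.prod I₂) (M₁ × M₂)}
  {X Y Z : Π x : M₁, TangentSpace I₁ x} {A B C : Π x : M₂, TangentSpace I₂ x} {p : M₁ × M₂}

theorem two_mul_inner_prodVectorField (hprod : IsRiemannianProduct I₁ M₁ I₂ M₂)
    (hg : CovariantDerivative.IsMetricCompatible
      (V := fun p : M₁ × M₂ ↦ TangentSpace (I₁.prod I₂) p) nabla) (hT : HasTorsionForm nabla T)
    (hX : MDiffAt (T% X) p.1) (hY : MDiffAt (T% Y) p.1) (hZ : MDiffAt (T% Z) p.1)
    (hA : MDiffAt (T% A) p.2) (hB : MDiffAt (T% B) p.2) (hC : MDiffAt (T% C) p.2) :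
    2 * inner ℝ (nabla (prodVectorField Y B) p (prodVectorField X A p)) (prodVectorField Z C p) =
      koszul I₁ X Y Z p.1 + koszul I₂ A B C p.2 +
        T.toFun p ![prodVectorField X A p, prodVectorField Y B p, prodVectorField Z C p] := by
  have : CompleteSpace E₁ := FiniteDimensional.complete ℝ E₁
  have : CompleteSpace E₂ := FiniteDimensional.complete ℝ E₂
  rw [two_mul_inner_eq_koszul_add_torsion hg hT (hX.prodVectorField hA) (hY.prodVectorField hB)
    (hZ.prodVectorField hC), hprod.koszul_prodVectorField hX hY hZ hA hB hC]

/-- `2 ∇_A X = T(A, X)` for fields `X` and `A` lifted from the first and second factor: in each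
factor, one of the first two arguments of the Koszul expression is zero. -/
theorem two_smul_nabla_inr_inl (hprod : IsRiemannianProduct I₁ M₁ I₂ M₂)
    (hg : CovariantDerivative.IsMetricCompatible
      (V := fun p : M₁ × M₂ ↦ TangentSpace (I₁.prod I₂) p) nabla) (hT : HasTorsionForm nabla T)
    (hX : MDiffAt (T% X) p.1) (hA : MDiffAt (T% A) p.2) :
    (2 : ℝ) • nabla (prodVectorField X (0 : Π x : M₂, TangentSpace I₂ x)) p
        (tangentInr I₁ I₂ p (A p.2)) =
      nabla.torsion p (tangentInr I₁ I₂ p (A p.2)) (tangentInl I₁ I₂ p (X p.1)) := by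
  refine ext_inner_right ℝ fun w ↦ ?_
  obtain ⟨Z, C, hZ, hC, rfl⟩ := exists_prodVectorField_eq w
  have h := two_mul_inner_prodVectorField hprod hg hT mdifferentiableAt_zero_vectorField hX hZ hA
    mdifferentiableAt_zero_vectorField hC
  rw [real_inner_smul_left, ← hT]
  rw [koszul_zero_left, koszul_zero_middle, zero_add, zero_add] at h
  exact h

/-- `2 ∇_X A = T(X, A)` for fields `X` and `A` lifted from the first and second factor. -/
theorem two_smul_nabla_inl_inr (hprod : IsRiemannianProduct I₁ M₁ I₂ M₂)
    (hg : CovariantDerivative.IsMetricCompatible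
      (V := fun p : M₁ × M₂ ↦ TangentSpace (I₁.prod I₂) p) nabla) (hT : HasTorsionForm nabla T)
    (hX : MDiffAt (T% X) p.1) (hA : MDiffAt (T% A) p.2) :
    (2 : ℝ) • nabla (prodVectorField (0 : Π x : M₁, TangentSpace I₁ x) A) p
        (tangentInl I₁ I₂ p (X p.1)) =
      nabla.torsion p (tangentInl I₁ I₂ p (X p.1)) (tangentInr I₁ I₂ p (A p.2)) := by
  refine ext_inner_right ℝ fun w ↦ ?_
  obtain ⟨Z, C, hZ, hC, rfl⟩ := exists_prodVectorField_eq w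
  have h := two_mul_inner_prodVectorField hprod hg hT hX mdifferentiableAt_zero_vectorField hZ
    mdifferentiableAt_zero_vectorField hA hC
  rw [real_inner_smul_left, ← hT]
  rw [koszul_zero_middle, koszul_zero_left, zero_add, zero_add] at h
  exact h

/-- The mixed torsion `T(X, A)` of a flat metric connection with skew torsion vanishes, since
`⟨R(X, A) A, X⟩ = -¼ ‖T(X, A)‖²`. -/
theorem torsion_inl_inr_eq_zero [T2Space M₁] [T2Space M₂] (hprod : IsRiemannianProduct I₁ M₁ I₂ M₂)
    (hnabla : IsFlatMetricConnection nabla) (hT : HasTorsionForm nabla T)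
    (v : TangentSpace I₁ p.1) (w : TangentSpace I₂ p.2) :
    nabla.torsion p (tangentInl I₁ I₂ p v) (tangentInr I₁ I₂ p w) = 0 := by
  have : CompleteSpace E₁ := FiniteDimensional.complete ℝ E₁
  have : CompleteSpace E₂ := FiniteDimensional.complete ℝ E₂
  have hg := hnabla.metric
  obtain ⟨X, hX, rfl⟩ := exists_contMDiff_section_eq I₁ (F := E₁) v
  obtain ⟨A, hA, rfl⟩ := exists_contMDiff_section_eq I₂ (F := E₂) w
  have hX' : ∀ x, MDiffAt (T% X) x := hX.mdifferentiable (by simp)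
  have hA' : ∀ x, MDiffAt (T% A) x := hA.mdifferentiable (by simp)
  have h0₁ : CMDiff ∞ (T% (0 : Π x : M₁, TangentSpace I₁ x)) := contMDiff_zero_vectorField
  have h0₂ : CMDiff ∞ (T% (0 : Π x : M₂, TangentSpace I₂ x)) := contMDiff_zero_vectorField
  have h0₁' : ∀ x, MDiffAt (T% (0 : Π x : M₁, TangentSpace I₁ x)) x :=
    h0₁.mdifferentiable (by simp)
  have h0₂' : ∀ x, MDiffAt (T% (0 : Π x : M₂, TangentSpace I₂ x)) x :=
    h0₂.mdifferentiable (by simp)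
  set X' : Π q : M₁ × M₂, TangentSpace (I₁.prod I₂) q := prodVectorField X 0 with hX'_def
  set A' : Π q : M₁ × M₂, TangentSpace (I₁.prod I₂) q := prodVectorField 0 A with hA'_def
  have cX : CMDiff ∞ (T% X') := hX.prodVectorField h0₂
  have cA : CMDiff ∞ (T% A') := h0₁.prodVectorField hA
  have mX : ∀ q, MDiffAt (T% X') q := cX.mdifferentiable (by simp)
  have mA : ∀ q, MDiffAt (T% A') q := cA.mdifferentiable (by simp)
  have mAA : ∀ q, MDiffAt (T% (fun q ↦ nabla A' q (A' q))) q :=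
    (CovariantDerivative.contMDiff_apply hnabla.smooth cA cA).mdifferentiable (by simp)
  have mXA : ∀ q, MDiffAt (T% (fun q ↦ nabla A' q (X' q))) q :=
    (CovariantDerivative.contMDiff_apply hnabla.smooth cX cA).mdifferentiable (by simp)
  have eXA : ∀ q, (2 : ℝ) • nabla A' q (X' q) = nabla.torsion q (X' q) (A' q) := fun q ↦
    two_smul_nabla_inl_inr hprod hg hT (hX' _) (hA' _)
  have eAX : ∀ q, (2 : ℝ) • nabla X' q (A' q) = nabla.torsion q (A' q) (X' q) := fun q ↦
    two_smul_nabla_inr_inl hprod hg hT (hX' _) (hA' _)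
  have alt₁₂ : ∀ q u v, T.toFun q ![u, u, v] = 0 := fun q u v ↦ by
    rw [hT, nabla.torsion_self, inner_zero_left]
  have alt₁₃ : ∀ q u v, T.toFun q ![u, v, u] = 0 := fun q u v ↦
    (T.toFun q).map_eq_zero_of_eq _ (i := 0) (j := 2) rfl (by decide)
  -- `∇_A A` has no component along the first factor, and `∇_X X` none along the second
  have fAA : ∀ q, tangentFst I₁ I₂ q (nabla A' q (A' q)) = 0 := by
    intro q
    refine ext_inner_right ℝ fun z ↦ ?_
    obtain ⟨Z, hZ, rfl⟩ := exists_contMDiff_section_eq I₁ (F := E₁) z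
    have h := two_mul_inner_prodVectorField hprod hg hT (h0₁' q.1) (h0₁' _)
      (hZ.mdifferentiable (by simp) _) (hA' q.2) (hA' _) (h0₂' _)
    rw [← hprod.inner_tangentInl, inner_zero_left]
    simpa [alt₁₂] using! h
  have sXX : ∀ q, tangentSnd I₁ I₂ q (nabla X' q (X' q)) = 0 := by
    intro q
    refine ext_inner_right ℝ fun z ↦ ?_
    obtain ⟨C, hC, rfl⟩ := exists_contMDiff_section_eq I₂ (F := E₂) z
    have h := two_mul_inner_prodVectorField hprod hg hT (hX' q.1) (hX' _) (h0₁' _)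
      (h0₂' q.2) (h0₂' _) (hC.mdifferentiable (by simp) _)
    rw [← hprod.inner_tangentInr, inner_zero_left]
    simpa [alt₁₂] using! h
  -- `⟨∇_X ∇_A A, X⟩ = 0`
  have d₁ : inner ℝ (nabla (fun q ↦ nabla A' q (A' q)) p (X' p)) (X' p) = 0 := by
    have h := hg.mvfderiv_inner_eq X' (mAA p) (mX p)
    have h₁ : (fun q ↦ inner ℝ (nabla A' q (A' q)) (X' q)) = fun _ ↦ (0 : ℝ) := by
      ext q
      rw [hX'_def, prodVectorField_zero_right, hprod.inner_tangentInl, fAA, inner_zero_left]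
    have h₂ : inner ℝ (nabla A' p (A' p)) (nabla X' p (X' p)) = 0 := by
      rw [hprod, fAA, sXX, inner_zero_left, inner_zero_right, add_zero]
    rw [h₁, mvfderiv_const] at h
    simpa [h₂] using h.symm
  -- `⟨∇_A ∇_X A, X⟩ = ¼ ‖T(X, A)‖²`
  have d₂ : 4 * inner ℝ (nabla (fun q ↦ nabla A' q (X' q)) p (A' p)) (X' p) =
      inner ℝ (nabla.torsion p (X' p) (A' p)) (nabla.torsion p (X' p) (A' p)) := by
    have h := hg.mvfderiv_inner_eq A' (mXA p) (mX p)
    have h₁ : (fun q ↦ inner ℝ (nabla A' q (X' q)) (X' q)) = fun _ ↦ (0 : ℝ) := by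
      ext q
      have h₂ : (2 : ℝ) * inner ℝ (nabla A' q (X' q)) (X' q) = 0 := by
        rw [← real_inner_smul_left, eXA, ← hT, alt₁₃]
      linarith
    have h₂ : 4 * inner ℝ (nabla A' p (X' p)) (nabla X' p (A' p)) =
        - inner ℝ (nabla.torsion p (X' p) (A' p)) (nabla.torsion p (X' p) (A' p)) := by
      rw [← inner_neg_right, ← nabla.torsion_antisymm, ← eXA, ← eAX, real_inner_smul_left,
        real_inner_smul_right]
      ring
    rw [h₁, mvfderiv_const] at h
    have h₃ : (0 : ℝ) = inner ℝ (nabla (fun q ↦ nabla A' q (X' q)) p (A' p)) (X' p) +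
      inner ℝ (nabla A' p (X' p)) (nabla X' p (A' p)) := h
    linarith
  have hR := hnabla.flat X' A' A' cX cA cA p
  have hbr : mlieBracket (I₁.prod I₂) X' A' p = 0 := by
    rw [hX'_def, hA'_def, mlieBracket_prodVectorField (hX' _) (h0₁' _) (h0₂' _) (hA' _),
      mlieBracket_zero_right, mlieBracket_zero_left]
    rfl
  rw [connectionCurvature, hbr, map_zero, sub_zero] at hR
  have hR' := congr(inner ℝ $hR (X' p))
  rw [inner_sub_left, d₁, inner_zero_left] at hR'
  refine (inner_self_eq_zero (𝕜 := ℝ)).1 (Eq.trans d₂.symm ?_)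
  linarith

end Product

/-! ### Restriction to slices -/

section Slice

variable {E₁ : Type*} [NormedAddCommGroup E₁] [NormedSpace ℝ E₁]
  {H₁ : Type*} [TopologicalSpace H₁] {I₁ : ModelWithCorners ℝ E₁ H₁}
  {M₁ : Type*} [TopologicalSpace M₁] [ChartedSpace H₁ M₁] [IsManifold I₁ ∞ M₁]
  {E₂ : Type*} [NormedAddCommGroup E₂] [NormedSpace ℝ E₂]
  {H₂ : Type*} [TopologicalSpace H₂] {I₂ : ModelWithCorners ℝ E₂ H₂}
  {M₂ : Type*} [TopologicalSpace M₂] [ChartedSpace H₂ M₂] [IsManifold I₂ ∞ M₂]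

/-- The connection on `M₁` induced by a connection on the product along the slice `M₁ × {x₂}`:
lift the field, differentiate in directions tangent to the slice, and project to `TM₁`. -/
def CovariantDerivative.sliceFst
    (nabla : CovariantDerivative (I₁.prod I₂) (E₁ × E₂)
      (TangentSpace (I₁.prod I₂) : M₁ × M₂ → Type _)) (x₂ : M₂) :
    CovariantDerivative I₁ E₁ (TangentSpace I₁ : M₁ → Type _) where
  toFun X x₁ := (tangentFst I₁ I₂ (x₁, x₂)).comp
    ((nabla (prodVectorField X 0) (x₁, x₂)).comp (tangentInl I₁ I₂ (x₁, x₂)))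
  isCovariantDerivativeOnUniv :=
    { add := by
        intro X Y x₁ hX hY _
        have h : prodVectorField (X + Y) (0 : Π x : M₂, TangentSpace I₂ x) =
            prodVectorField X 0 + prodVectorField Y 0 := by
          ext q
          simp only [Pi.add_apply, prodVectorField_zero_right, map_add]
        rw [h, nabla.isCovariantDerivativeOnUniv.add
          (MDifferentiableAt.prodVectorField hX mdifferentiableAt_zero_vectorField)
          (MDifferentiableAt.prodVectorField hY mdifferentiableAt_zero_vectorField)]
        ext v
        exact map_add (tangentFst I₁ I₂ (x₁, x₂)) _ _
      leibniz := by
        intro X g x₁ hX hg _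
        have h : prodVectorField (g • X) (0 : Π x : M₂, TangentSpace I₂ x) =
            (g ∘ (Prod.fst : M₁ × M₂ → M₁)) •
              (prodVectorField X 0 : Π q : M₁ × M₂, TangentSpace (I₁.prod I₂) q) := by
          ext q
          simp only [Pi.smul_apply', prodVectorField_zero_right, map_smul, Function.comp_apply]
        have hv (v : TangentSpace I₁ x₁) : mvfderiv (I₁.prod I₂) (g ∘ Prod.fst) (x₁, x₂)
            (tangentInl I₁ I₂ (x₁, x₂) v) = d% g x₁ v := by
          have e := mvfderiv_comp (x₁, x₂) hg (mdifferentiableAt_fst (I := I₁) (I' := I₂))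
          refine congr($e (tangentInl I₁ I₂ (x₁, x₂) v)).trans (congrArg (d% g x₁) ?_)
          exact tangentFst_tangentInl v
        have key := nabla.isCovariantDerivativeOnUniv.leibniz (x := (x₁, x₂))
          (MDifferentiableAt.prodVectorField hX (mdifferentiableAt_zero_vectorField (I := I₂)))
          (hg.comp (x₁, x₂) (mdifferentiableAt_fst (I := I₁) (I' := I₂)))
        rw [← h] at key
        ext v
        have e := congr(tangentFst I₁ I₂ (x₁, x₂) ($key (tangentInl I₁ I₂ (x₁, x₂) v)))
        simp only [add_apply, smul_apply, ContinuousLinearMap.smulRight_apply, map_add, map_smul,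
          hv, prodVectorField_zero_right] at e
        exact e.trans (congrArg (_ + d% g x₁ v • ·)
          (tangentFst_tangentInl (p := (x₁, x₂)) (X x₁))) }

/-- The connection on `M₂` induced by a connection on the product along the slice `{x₁} × M₂`. -/
def CovariantDerivative.sliceSnd
    (nabla : CovariantDerivative (I₁.prod I₂) (E₁ × E₂)
      (TangentSpace (I₁.prod I₂) : M₁ × M₂ → Type _)) (x₁ : M₁) :
    CovariantDerivative I₂ E₂ (TangentSpace I₂ : M₂ → Type _) where
  toFun A x₂ := (tangentSnd I₁ I₂ (x₁, x₂)).comp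
    ((nabla (prodVectorField 0 A) (x₁, x₂)).comp (tangentInr I₁ I₂ (x₁, x₂)))
  isCovariantDerivativeOnUniv :=
    { add := by
        intro A B x₂ hA hB _
        have h : prodVectorField (0 : Π x : M₁, TangentSpace I₁ x) (A + B) =
            prodVectorField 0 A + prodVectorField 0 B := by
          ext q
          simp only [Pi.add_apply, prodVectorField_zero_left, map_add]
        rw [h, nabla.isCovariantDerivativeOnUniv.add
          (MDifferentiableAt.prodVectorField mdifferentiableAt_zero_vectorField hA)
          (MDifferentiableAt.prodVectorField mdifferentiableAt_zero_vectorField hB)]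
        ext v
        exact map_add (tangentSnd I₁ I₂ (x₁, x₂)) _ _
      leibniz := by
        intro A g x₂ hA hg _
        have h : prodVectorField (0 : Π x : M₁, TangentSpace I₁ x) (g • A) =
            (g ∘ (Prod.snd : M₁ × M₂ → M₂)) •
              (prodVectorField 0 A : Π q : M₁ × M₂, TangentSpace (I₁.prod I₂) q) := by
          ext q
          simp only [Pi.smul_apply', prodVectorField_zero_left, map_smul, Function.comp_apply]
        have hv (v : TangentSpace I₂ x₂) : mvfderiv (I₁.prod I₂) (g ∘ Prod.snd) (x₁, x₂)
            (tangentInr I₁ I₂ (x₁, x₂) v) = d% g x₂ v := by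
          have e := mvfderiv_comp (x₁, x₂) hg (mdifferentiableAt_snd (I := I₁) (I' := I₂))
          refine congr($e (tangentInr I₁ I₂ (x₁, x₂) v)).trans (congrArg (d% g x₂) ?_)
          exact tangentSnd_tangentInr v
        have key := nabla.isCovariantDerivativeOnUniv.leibniz (x := (x₁, x₂))
          (MDifferentiableAt.prodVectorField (mdifferentiableAt_zero_vectorField (I := I₁)) hA)
          (hg.comp (x₁, x₂) (mdifferentiableAt_snd (I := I₁) (I' := I₂)))
        rw [← h] at key
        ext v
        have e := congr(tangentSnd I₁ I₂ (x₁, x₂) ($key (tangentInr I₁ I₂ (x₁, x₂) v)))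
        simp only [add_apply, smul_apply, ContinuousLinearMap.smulRight_apply, map_add, map_smul,
          hv, prodVectorField_zero_left] at e
        exact e.trans (congrArg (_ + d% g x₂ v • ·)
          (tangentSnd_tangentInr (p := (x₁, x₂)) (A x₂))) }

theorem CovariantDerivative.sliceFst_apply
    (nabla : CovariantDerivative (I₁.prod I₂) (E₁ × E₂)
      (TangentSpace (I₁.prod I₂) : M₁ × M₂ → Type _)) (x₂ : M₂) (X : Π x : M₁, TangentSpace I₁ x)
      (x₁ : M₁) (v : TangentSpace I₁ x₁) :
    nabla.sliceFst x₂ X x₁ v = tangentFst I₁ I₂ (x₁, x₂)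
      (nabla (prodVectorField X 0) (x₁, x₂) (tangentInl I₁ I₂ (x₁, x₂) v)) := rfl

theorem CovariantDerivative.sliceSnd_apply
    (nabla : CovariantDerivative (I₁.prod I₂) (E₁ × E₂)
      (TangentSpace (I₁.prod I₂) : M₁ × M₂ → Type _)) (x₁ : M₁) (A : Π x : M₂, TangentSpace I₂ x)
      (x₂ : M₂) (v : TangentSpace I₂ x₂) :
    nabla.sliceSnd x₁ A x₂ v = tangentSnd I₁ I₂ (x₁, x₂)
      (nabla (prodVectorField 0 A) (x₁, x₂) (tangentInr I₁ I₂ (x₁, x₂) v)) := rfl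

theorem contMDiff_sliceFst [FiniteDimensional ℝ E₁] [T2Space M₁]
    {nabla : CovariantDerivative (I₁.prod I₂) (E₁ × E₂)
      (TangentSpace (I₁.prod I₂) : M₁ × M₂ → Type _)}
    (hs : CovariantDerivative.ContMDiffCovariantDerivative nabla ∞) (x₂ : M₂) :
    CovariantDerivative.ContMDiffCovariantDerivative (nabla.sliceFst x₂) ∞ where
  contMDiff :=
    { contMDiff := by
        intro X hX
        rw [contMDiffOn_univ] at hX ⊢
        refine contMDiff_hom_section_of_apply fun σ hσ ↦ ?_
        have h := CovariantDerivative.contMDiff_apply hs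
          (hσ.prodVectorField (contMDiff_zero_vectorField (I := I₂) (M := M₂)))
          (ContMDiff.prodVectorField hX (contMDiff_zero_vectorField (I := I₂) (M := M₂)))
        have h' := (contMDiff_fst.comp (contMDiff_equivTangentBundleProd.comp h)).comp
          (contMDiff_id.prodMk contMDiff_const : CMDiff ∞ fun x : M₁ ↦ (x, x₂))
        convert! h' using 2 with x
        rw [CovariantDerivative.sliceFst_apply, tangentFst_apply]
        rfl }

/-- The pull-back of a `3`-form on the product under the inclusion `x₁ ↦ (x₁, x₂)`. -/
def ThreeForm.sliceFst (T : ThreeForm (I₁.prod I₂) (M₁ × M₂)) (x₂ : M₂) : ThreeForm I₁ M₁ where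
  toFun x₁ := (T.toFun (x₁, x₂)).compContinuousLinearMap (tangentInl I₁ I₂ (x₁, x₂))
  smooth' X hX :=
    (T.smooth' (fun i ↦ prodVectorField (X i) 0)
      fun i ↦ ContMDiff.prodVectorField (hX i) contMDiff_zero_vectorField).comp
      (contMDiff_id.prodMk contMDiff_const : CMDiff ∞ fun x : M₁ ↦ (x, x₂))

theorem contMDiff_sliceSnd [FiniteDimensional ℝ E₂] [T2Space M₂]
    {nabla : CovariantDerivative (I₁.prod I₂) (E₁ × E₂)
      (TangentSpace (I₁.prod I₂) : M₁ × M₂ → Type _)}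
    (hs : CovariantDerivative.ContMDiffCovariantDerivative nabla ∞) (x₁ : M₁) :
    CovariantDerivative.ContMDiffCovariantDerivative (nabla.sliceSnd x₁) ∞ where
  contMDiff :=
    { contMDiff := by
        intro A hA
        rw [contMDiffOn_univ] at hA ⊢
        refine contMDiff_hom_section_of_apply fun σ hσ ↦ ?_
        have h := CovariantDerivative.contMDiff_apply hs
          ((contMDiff_zero_vectorField (I := I₁) (M := M₁)).prodVectorField hσ)
          (ContMDiff.prodVectorField (contMDiff_zero_vectorField (I := I₁) (M := M₁)) hA)
        have h' := (contMDiff_snd.comp (contMDiff_equivTangentBundleProd.comp h)).comp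
          (contMDiff_const.prodMk contMDiff_id : CMDiff ∞ fun x : M₂ ↦ (x₁, x))
        convert! h' using 2 with x
        rw [CovariantDerivative.sliceSnd_apply, tangentSnd_apply]
        rfl }

/-- The pull-back of a `3`-form on the product under the inclusion `x₂ ↦ (x₁, x₂)`. -/
def ThreeForm.sliceSnd (T : ThreeForm (I₁.prod I₂) (M₁ × M₂)) (x₁ : M₁) : ThreeForm I₂ M₂ where
  toFun x₂ := (T.toFun (x₁, x₂)).compContinuousLinearMap (tangentInr I₁ I₂ (x₁, x₂))
  smooth' A hA :=
    (T.smooth' (fun i ↦ prodVectorField 0 (A i))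
      fun i ↦ ContMDiff.prodVectorField contMDiff_zero_vectorField (hA i)).comp
      (contMDiff_const.prodMk contMDiff_id : CMDiff ∞ fun x : M₂ ↦ (x₁, x))

end Slice

/-! ### Determination by smooth fields, and metricity at a tangent vector -/

section Uniqueness

variable {E : Type*} [NormedAddCommGroup E] [NormedSpace ℝ E] [FiniteDimensional ℝ E]
  {H : Type*} [TopologicalSpace H] {I : ModelWithCorners ℝ E H}
  {M : Type*} [TopologicalSpace M] [ChartedSpace H M] [IsManifold I ∞ M] [T2Space M]

/-- Two connections that agree at a point on smooth fields agree there on all differentiable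
fields, because their difference is tensorial. -/
theorem CovariantDerivative.eq_of_contMDiff
    {nabla nabla' : CovariantDerivative I E (TangentSpace I : M → Type _)} {x : M}
    (h : ∀ Y : Π x : M, TangentSpace I x, CMDiff ∞ (T% Y) → nabla Y x = nabla' Y x)
    {Y : Π x : M, TangentSpace I x} (hY : MDiffAt (T% Y) x) : nabla Y x = nabla' Y x := by
  obtain ⟨Z, hZ, hZY⟩ := exists_contMDiff_section_eq I (F := E) (Y x)
  have h₁ := IsCovariantDerivativeOn.difference_apply nabla.isCovariantDerivativeOnUniv
    nabla'.isCovariantDerivativeOnUniv (mem_univ x) hY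
  have h₂ := IsCovariantDerivativeOn.difference_apply nabla.isCovariantDerivativeOnUniv
    nabla'.isCovariantDerivativeOnUniv (mem_univ x) (hZ.mdifferentiable (by simp) x)
  rw [← hZY, h₂, h Z hZ, sub_self] at h₁
  exact (sub_eq_zero.1 h₁.symm)

end Uniqueness

section Metric

variable {E : Type*} [NormedAddCommGroup E] [NormedSpace ℝ E] [FiniteDimensional ℝ E]
  {H : Type*} [TopologicalSpace H] {I : ModelWithCorners ℝ E H}
  {M : Type*} [TopologicalSpace M] [ChartedSpace H M] [IsManifold I ∞ M]
  [RiemannianBundle (fun x : M ↦ TangentSpace I x)]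
  [IsContMDiffRiemannianBundle I ∞ E (fun x : M ↦ TangentSpace I x)]

theorem CovariantDerivative.IsMetricCompatible.mvfderiv_inner_apply
    {nabla : CovariantDerivative I E (TangentSpace I : M → Type _)}
    (hg : CovariantDerivative.IsMetricCompatible (V := fun x : M ↦ TangentSpace I x) nabla)
    {X Y : Π x : M, TangentSpace I x} {x : M} (hX : MDiffAt (T% X) x) (hY : MDiffAt (T% Y) x)
    (v : TangentSpace I x) :
    (d% (fun y ↦ inner ℝ (X y) (Y y)) x) v =
      inner ℝ (nabla X x v) (Y x) + inner ℝ (X x) (nabla Y x v) := by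
  simpa using! hg.mvfderiv_inner_eq (FiberBundle.extend E v) hX hY

/-- The criterion `CovariantDerivative.isMetricCompatible_iff`, stated with the instances carried
by the tangent bundle. -/
theorem CovariantDerivative.isMetricCompatible_of_apply
    {nabla : CovariantDerivative I E (TangentSpace I : M → Type _)}
    (h : ∀ (x : M) (X Y Z : Π x : M, TangentSpace I x), MDiffAt (T% Y) x → MDiffAt (T% Z) x →
      (d% (fun y ↦ inner ℝ (Y y) (Z y)) x) (X x) =
        inner ℝ (nabla Y x (X x)) (Z x) + inner ℝ (Y x) (nabla Z x (X x))) :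
    CovariantDerivative.IsMetricCompatible (V := fun x : M ↦ TangentSpace I x) nabla := by
  have : IsManifold I 1 M := IsManifold.of_le (n := ∞) (by simp)
  rw [CovariantDerivative.isMetricCompatible_iff]
  exact fun {x X Y Z} _ hY hZ ↦ h x X Y Z hY hZ

end Metric

/-! ### The connection splits -/

section Product

variable {E₁ : Type*} [NormedAddCommGroup E₁] [NormedSpace ℝ E₁] [FiniteDimensional ℝ E₁]
  {H₁ : Type*} [TopologicalSpace H₁] {I₁ : ModelWithCorners ℝ E₁ H₁}
  {M₁ : Type*} [TopologicalSpace M₁] [ChartedSpace H₁ M₁] [IsManifold I₁ ∞ M₁] [T2Space M₁]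
  {E₂ : Type*} [NormedAddCommGroup E₂] [NormedSpace ℝ E₂] [FiniteDimensional ℝ E₂]
  {H₂ : Type*} [TopologicalSpace H₂] {I₂ : ModelWithCorners ℝ E₂ H₂}
  {M₂ : Type*} [TopologicalSpace M₂] [ChartedSpace H₂ M₂] [IsManifold I₂ ∞ M₂] [T2Space M₂]
  [RiemannianBundle (fun x : M₁ ↦ TangentSpace I₁ x)]
  [IsContMDiffRiemannianBundle I₁ ∞ E₁ (fun x : M₁ ↦ TangentSpace I₁ x)]
  [RiemannianBundle (fun x : M₂ ↦ TangentSpace I₂ x)]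
  [IsContMDiffRiemannianBundle I₂ ∞ E₂ (fun x : M₂ ↦ TangentSpace I₂ x)]
  [RiemannianBundle (fun p : M₁ × M₂ ↦ TangentSpace (I₁.prod I₂) p)]
  [IsContMDiffRiemannianBundle (I₁.prod I₂) ∞ (E₁ × E₂)
    (fun p : M₁ × M₂ ↦ TangentSpace (I₁.prod I₂) p)]
  {nabla : CovariantDerivative (I₁.prod I₂) (E₁ × E₂)
      (TangentSpace (I₁.prod I₂) : M₁ × M₂ → Type _)}
  {T : ThreeForm (I₁.prod I₂) (M₁ × M₂)}
  {X Y : Π x : M₁, TangentSpace I₁ x} {A B : Π x : M₂, TangentSpace I₂ x} {p : M₁ × M₂}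

/-- `∇_A X = 0` for fields lifted from different factors. -/
theorem nabla_inl_tangentInr_eq_zero (hprod : IsRiemannianProduct I₁ M₁ I₂ M₂)
    (hnabla : IsFlatMetricConnection nabla) (hT : HasTorsionForm nabla T)
    (hX : MDiffAt (T% X) p.1) (w : TangentSpace I₂ p.2) :
    nabla (prodVectorField X 0) p (tangentInr I₁ I₂ p w) = 0 := by
  have h := two_smul_nabla_inr_inl hprod hnabla.metric hT hX
    (FiberBundle.mdifferentiableAt_extend I₂ E₂ w)
  rw [FiberBundle.extend_apply_self, nabla.torsion_antisymm,
    torsion_inl_inr_eq_zero hprod hnabla hT, neg_zero] at h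
  exact (smul_eq_zero.1 h).resolve_left two_ne_zero

/-- `∇_X A = 0` for fields lifted from different factors. -/
theorem nabla_inr_tangentInl_eq_zero (hprod : IsRiemannianProduct I₁ M₁ I₂ M₂)
    (hnabla : IsFlatMetricConnection nabla) (hT : HasTorsionForm nabla T)
    (hA : MDiffAt (T% A) p.2) (v : TangentSpace I₁ p.1) :
    nabla (prodVectorField 0 A) p (tangentInl I₁ I₂ p v) = 0 := by
  have h := two_smul_nabla_inl_inr hprod hnabla.metric hT
    (FiberBundle.mdifferentiableAt_extend I₁ E₁ v) hA
  rw [FiberBundle.extend_apply_self, torsion_inl_inr_eq_zero hprod hnabla hT] at h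
  exact (smul_eq_zero.1 h).resolve_left two_ne_zero

/-- The covariant derivatives of a field lifted from `M₁` are tangent to `M₁`: for `C` lifted from
`M₂` one has `⟨X, C⟩ = 0` and `∇_V C = 0`, hence `⟨∇_V X, C⟩ = 0`. -/
theorem tangentSnd_nabla_inl (hprod : IsRiemannianProduct I₁ M₁ I₂ M₂)
    (hnabla : IsFlatMetricConnection nabla) (hT : HasTorsionForm nabla T)
    (hX : MDiffAt (T% X) p.1) (v : TangentSpace (I₁.prod I₂) p) :
    tangentSnd I₁ I₂ p (nabla (prodVectorField X 0) p v) = 0 := by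
  rw [← tangentInl_add_tangentInr v, map_add, nabla_inl_tangentInr_eq_zero hprod hnabla hT hX,
    add_zero]
  refine ext_inner_right ℝ fun w ↦ ?_
  have hC : MDiffAt (T% (FiberBundle.extend E₂ w)) p.2 :=
    FiberBundle.mdifferentiableAt_extend I₂ E₂ w
  have h := hnabla.metric.mvfderiv_inner_apply
    (MDifferentiableAt.prodVectorField hX mdifferentiableAt_zero_vectorField)
    (MDifferentiableAt.prodVectorField mdifferentiableAt_zero_vectorField hC)
    (tangentInl I₁ I₂ p (tangentFst I₁ I₂ p v))
  have h₀ : (fun q ↦ inner ℝ (prodVectorField X (0 : Π x : M₂, TangentSpace I₂ x) q)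
      (prodVectorField (0 : Π x : M₁, TangentSpace I₁ x) (FiberBundle.extend E₂ w) q)) =
      fun _ ↦ (0 : ℝ) := by
    ext q
    rw [hprod.inner_prodVectorField, Pi.zero_apply, Pi.zero_apply, inner_zero_left,
      inner_zero_right, add_zero]
  rw [h₀, mvfderiv_const, nabla_inr_tangentInl_eq_zero hprod hnabla hT hC, inner_zero_right,
    add_zero, prodVectorField_zero_left, hprod.inner_tangentInr,
    FiberBundle.extend_apply_self] at h
  rw [← h, inner_zero_left]
  rfl

/-- The covariant derivatives of a field lifted from `M₂` are tangent to `M₂`. -/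
theorem tangentFst_nabla_inr (hprod : IsRiemannianProduct I₁ M₁ I₂ M₂)
    (hnabla : IsFlatMetricConnection nabla) (hT : HasTorsionForm nabla T)
    (hA : MDiffAt (T% A) p.2) (v : TangentSpace (I₁.prod I₂) p) :
    tangentFst I₁ I₂ p (nabla (prodVectorField 0 A) p v) = 0 := by
  rw [← tangentInl_add_tangentInr v, map_add, nabla_inr_tangentInl_eq_zero hprod hnabla hT hA,
    zero_add]
  refine ext_inner_right ℝ fun w ↦ ?_
  have hZ : MDiffAt (T% (FiberBundle.extend E₁ w)) p.1 :=
    FiberBundle.mdifferentiableAt_extend I₁ E₁ w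
  have h := hnabla.metric.mvfderiv_inner_apply
    (MDifferentiableAt.prodVectorField mdifferentiableAt_zero_vectorField hA)
    (MDifferentiableAt.prodVectorField hZ mdifferentiableAt_zero_vectorField)
    (tangentInr I₁ I₂ p (tangentSnd I₁ I₂ p v))
  have h₀ : (fun q ↦ inner ℝ (prodVectorField (0 : Π x : M₁, TangentSpace I₁ x) A q)
      (prodVectorField (FiberBundle.extend E₁ w) (0 : Π x : M₂, TangentSpace I₂ x) q)) =
      fun _ ↦ (0 : ℝ) := by
    ext q
    rw [hprod.inner_prodVectorField, Pi.zero_apply, Pi.zero_apply, inner_zero_left,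
      inner_zero_right, add_zero]
  rw [h₀, mvfderiv_const, nabla_inl_tangentInr_eq_zero hprod hnabla hT hZ, inner_zero_right,
    add_zero, prodVectorField_zero_right, hprod.inner_tangentInl,
    FiberBundle.extend_apply_self] at h
  rw [← h, inner_zero_left]
  rfl

/-- The connections induced on `M₁` along any two slices coincide. -/
theorem sliceFst_eq_sliceFst [I₂.Boundaryless] [ConnectedSpace M₂]
    (hprod : IsRiemannianProduct I₁ M₁ I₂ M₂)
    (hnabla : IsFlatMetricConnection nabla) (hT : HasTorsionForm nabla T) {x₁ : M₁}
    (hX : MDiffAt (T% X) x₁) (y z : M₂) :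
    nabla.sliceFst y X x₁ = nabla.sliceFst z X x₁ := by
  refine CovariantDerivative.eq_of_contMDiff (fun X hX ↦ ?_) hX
  have : CompleteSpace E₁ := FiniteDimensional.complete ℝ E₁
  have : CompleteSpace E₂ := FiniteDimensional.complete ℝ E₂
  ext v
  refine ext_inner_right ℝ fun w ↦ ?_
  obtain ⟨V, hV, rfl⟩ := exists_contMDiff_section_eq I₁ (F := E₁) v
  obtain ⟨W, hW, rfl⟩ := exists_contMDiff_section_eq I₁ (F := E₁) w
  have h0 : CMDiff ∞ (T% (0 : Π x : M₂, TangentSpace I₂ x)) := contMDiff_zero_vectorField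
  have cX := hX.prodVectorField h0
  have cV := hV.prodVectorField h0
  have cW := hW.prodVectorField h0
  set X' : Π q : M₁ × M₂, TangentSpace (I₁.prod I₂) q := prodVectorField X 0 with hX'
  set V' : Π q : M₁ × M₂, TangentSpace (I₁.prod I₂) q := prodVectorField V 0 with hV'
  set W' : Π q : M₁ × M₂, TangentSpace (I₁.prod I₂) q := prodVectorField W 0 with hW'
  have mN := (CovariantDerivative.contMDiff_apply hnabla.smooth cV cX).mdifferentiable (by simp)
  have mW := cW.mdifferentiable (by simp)
  have hF : MDiff (fun q ↦ inner ℝ (nabla X' q (V' q)) (W' q)) := fun q ↦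
    (mN q).inner_vectorField (mW q)
  -- `⟨∇_V X, W⟩` has vanishing derivative along the second factor, since `∇_C W = 0` and
  -- `∇_C ∇_V X = R(C, V) X + ∇_V ∇_C X = 0`
  have hdF (q : M₁ × M₂) (c : TangentSpace I₂ q.2) :
      mvfderiv (I₁.prod I₂) (fun q ↦ inner ℝ (nabla X' q (V' q)) (W' q)) q
        (tangentInr I₁ I₂ q c) = 0 := by
    obtain ⟨C, hC, rfl⟩ := exists_contMDiff_section_eq I₂ (F := E₂) c
    have hR := hnabla.flat (prodVectorField 0 C) V' X'
      (contMDiff_zero_vectorField.prodVectorField hC) cV cX q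
    have hz : (fun q ↦ nabla X' q (prodVectorField 0 C q)) = 0 := by
      ext q
      exact nabla_inl_tangentInr_eq_zero hprod hnabla hT (hX.mdifferentiable (by simp) _) _
    have hbr : mlieBracket (I₁.prod I₂) (prodVectorField 0 C) V' q = 0 := by
      rw [hV', mlieBracket_prodVectorField mdifferentiableAt_zero_vectorField
        (hV.mdifferentiable (by simp) _) (hC.mdifferentiable (by simp) _)
        mdifferentiableAt_zero_vectorField, mlieBracket_zero_right, mlieBracket_zero_left]
      rfl
    rw [connectionCurvature, hz, hbr, map_zero, sub_zero, nabla.zero, Pi.zero_apply,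
      zero_apply, sub_zero, prodVectorField_zero_left] at hR
    rw [hnabla.metric.mvfderiv_inner_apply (mN q) (mW q), hR, hW',
      nabla_inl_tangentInr_eq_zero hprod hnabla hT (hW.mdifferentiable (by simp) _),
      inner_zero_left, inner_zero_right, add_zero]
  have hf : ∀ x₂ : M₂, inner ℝ (nabla.sliceFst x₂ X x₁ (V x₁)) (W x₁) =
      ((fun q ↦ inner ℝ (nabla X' q (V' q)) (W' q)) ∘ fun x : M₂ ↦ (x₁, x)) x₂ := fun x₂ ↦
    (hprod.inner_tangentInl (p := (x₁, x₂)) _ _).symm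
  have hi : MDiff (fun x : M₂ ↦ (x₁, x)) := mdifferentiable_const.prodMk mdifferentiable_id
  rw [hf, hf]
  refine eq_of_mvfderiv_eq_zero (I := I₂) (hF.comp hi) (fun x₂ c ↦ ?_) y z
  rw [mvfderiv_comp x₂ (hF _) (hi _), mfderiv_prod_right]
  exact hdF (x₁, x₂) c

/-- The connections induced on `M₂` along any two slices coincide. -/
theorem sliceSnd_eq_sliceSnd [I₁.Boundaryless] [ConnectedSpace M₁]
    (hprod : IsRiemannianProduct I₁ M₁ I₂ M₂)
    (hnabla : IsFlatMetricConnection nabla) (hT : HasTorsionForm nabla T) {x₂ : M₂}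
    (hA : MDiffAt (T% A) x₂) (y z : M₁) :
    nabla.sliceSnd y A x₂ = nabla.sliceSnd z A x₂ := by
  refine CovariantDerivative.eq_of_contMDiff (fun A hA ↦ ?_) hA
  have : CompleteSpace E₂ := FiniteDimensional.complete ℝ E₂
  have : CompleteSpace E₁ := FiniteDimensional.complete ℝ E₁
  ext v
  refine ext_inner_right ℝ fun w ↦ ?_
  obtain ⟨B, hB, rfl⟩ := exists_contMDiff_section_eq I₂ (F := E₂) v
  obtain ⟨D, hD, rfl⟩ := exists_contMDiff_section_eq I₂ (F := E₂) w
  have h0 : CMDiff ∞ (T% (0 : Π x : M₁, TangentSpace I₁ x)) := contMDiff_zero_vectorField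
  have cA := h0.prodVectorField hA
  have cB := h0.prodVectorField hB
  have cD := h0.prodVectorField hD
  set A' : Π q : M₁ × M₂, TangentSpace (I₁.prod I₂) q := prodVectorField 0 A with hA'
  set B' : Π q : M₁ × M₂, TangentSpace (I₁.prod I₂) q := prodVectorField 0 B with hB'
  set D' : Π q : M₁ × M₂, TangentSpace (I₁.prod I₂) q := prodVectorField 0 D with hD'
  have mN := (CovariantDerivative.contMDiff_apply hnabla.smooth cB cA).mdifferentiable (by simp)
  have mD := cD.mdifferentiable (by simp)
  have hF : MDiff (fun q ↦ inner ℝ (nabla A' q (B' q)) (D' q)) := fun q ↦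
    (mN q).inner_vectorField (mD q)
  -- `⟨∇_B A, D⟩` has vanishing derivative along the first factor, since `∇_X D = 0` and
  -- `∇_X ∇_B A = R(X, B) A + ∇_B ∇_X A = 0`
  have hdF (q : M₁ × M₂) (c : TangentSpace I₁ q.1) :
      mvfderiv (I₁.prod I₂) (fun q ↦ inner ℝ (nabla A' q (B' q)) (D' q)) q
        (tangentInl I₁ I₂ q c) = 0 := by
    obtain ⟨X, hX, rfl⟩ := exists_contMDiff_section_eq I₁ (F := E₁) c
    have hR := hnabla.flat (prodVectorField X 0) B' A'
      (hX.prodVectorField contMDiff_zero_vectorField) cB cA q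
    have hz : (fun q ↦ nabla A' q (prodVectorField X 0 q)) = 0 := by
      ext q
      exact nabla_inr_tangentInl_eq_zero hprod hnabla hT (hA.mdifferentiable (by simp) _) _
    have hbr : mlieBracket (I₁.prod I₂) (prodVectorField X 0) B' q = 0 := by
      rw [hB', mlieBracket_prodVectorField (hX.mdifferentiable (by simp) _)
        mdifferentiableAt_zero_vectorField mdifferentiableAt_zero_vectorField
        (hB.mdifferentiable (by simp) _), mlieBracket_zero_right, mlieBracket_zero_left]
      rfl
    rw [connectionCurvature, hz, hbr, map_zero, sub_zero, nabla.zero, Pi.zero_apply,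
      zero_apply, sub_zero, prodVectorField_zero_right] at hR
    rw [hnabla.metric.mvfderiv_inner_apply (mN q) (mD q), hR, hD',
      nabla_inr_tangentInl_eq_zero hprod hnabla hT (hD.mdifferentiable (by simp) _),
      inner_zero_left, inner_zero_right, add_zero]
  have hf : ∀ x₁ : M₁, inner ℝ (nabla.sliceSnd x₁ A x₂ (B x₂)) (D x₂) =
      ((fun q ↦ inner ℝ (nabla A' q (B' q)) (D' q)) ∘ fun x : M₁ ↦ (x, x₂)) x₁ := fun x₁ ↦
    (hprod.inner_tangentInr (p := (x₁, x₂)) _ _).symm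
  have hi : MDiff (fun x : M₁ ↦ (x, x₂)) := mdifferentiable_id.prodMk mdifferentiable_const
  rw [hf, hf]
  refine eq_of_mvfderiv_eq_zero (I := I₁) (hF.comp hi) (fun x₁ c ↦ ?_) y z
  rw [mvfderiv_comp x₁ (hF _) (hi _), mfderiv_prod_left]
  exact hdF (x₁, x₂) c

/-- A flat metric connection with skew torsion on a Riemannian product is the product of the
connections that it induces on the two slices through any base point. -/
theorem isProductConnection_slice [I₁.Boundaryless] [I₂.Boundaryless] [ConnectedSpace M₁]
    [ConnectedSpace M₂] (hprod : IsRiemannianProduct I₁ M₁ I₂ M₂)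
    (hnabla : IsFlatMetricConnection nabla) (hT : HasTorsionForm nabla T) (p₀ : M₁ × M₂) :
    IsProductConnection nabla (nabla.sliceFst p₀.2) (nabla.sliceSnd p₀.1) := by
  intro X A p hX hA v
  have key : nabla (prodVectorField X A) p v =
      nabla (prodVectorField X 0) p (tangentInl I₁ I₂ p (tangentFst I₁ I₂ p v)) +
        nabla (prodVectorField 0 A) p (tangentInr I₁ I₂ p (tangentSnd I₁ I₂ p v)) := by
    conv_lhs => rw [prodVectorField_eq_add, nabla.isCovariantDerivativeOnUniv.add
      (MDifferentiableAt.prodVectorField hX mdifferentiableAt_zero_vectorField)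
      (MDifferentiableAt.prodVectorField mdifferentiableAt_zero_vectorField hA),
      ← tangentInl_add_tangentInr v]
    rw [add_apply, map_add, map_add, nabla_inl_tangentInr_eq_zero hprod hnabla hT hX,
      nabla_inr_tangentInl_eq_zero hprod hnabla hT hA, add_zero, zero_add]
  rw [key, map_add, map_add, tangentFst_nabla_inr hprod hnabla hT hA,
    tangentSnd_nabla_inl hprod hnabla hT hX, add_zero, zero_add,
    sliceFst_eq_sliceFst hprod hnabla hT hX p₀.2 p.2,
    sliceSnd_eq_sliceSnd hprod hnabla hT hA p₀.1 p.1]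
  exact ⟨rfl, rfl⟩

end Product

/-! ### Curvature, torsion and metricity of a product connection -/

section ProductConnection

variable {E₁ : Type*} [NormedAddCommGroup E₁] [NormedSpace ℝ E₁]
  {H₁ : Type*} [TopologicalSpace H₁] {I₁ : ModelWithCorners ℝ E₁ H₁}
  {M₁ : Type*} [TopologicalSpace M₁] [ChartedSpace H₁ M₁] [IsManifold I₁ ∞ M₁]
  {E₂ : Type*} [NormedAddCommGroup E₂] [NormedSpace ℝ E₂]
  {H₂ : Type*} [TopologicalSpace H₂] {I₂ : ModelWithCorners ℝ E₂ H₂}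
  {M₂ : Type*} [TopologicalSpace M₂] [ChartedSpace H₂ M₂] [IsManifold I₂ ∞ M₂]
  {nabla : CovariantDerivative (I₁.prod I₂) (E₁ × E₂)
      (TangentSpace (I₁.prod I₂) : M₁ × M₂ → Type _)}
  {nabla₁ : CovariantDerivative I₁ E₁ (TangentSpace I₁ : M₁ → Type _)}
  {nabla₂ : CovariantDerivative I₂ E₂ (TangentSpace I₂ : M₂ → Type _)}
  {X Y Z : Π x : M₁, TangentSpace I₁ x} {A B C : Π x : M₂, TangentSpace I₂ x} {p : M₁ × M₂}

namespace IsProductConnection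

theorem apply (h : IsProductConnection nabla nabla₁ nabla₂)
    (hX : MDiffAt (T% X) p.1) (hA : MDiffAt (T% A) p.2) (v : TangentSpace (I₁.prod I₂) p) :
    nabla (prodVectorField X A) p v = tangentInl I₁ I₂ p (nabla₁ X p.1 (tangentFst I₁ I₂ p v)) +
      tangentInr I₁ I₂ p (nabla₂ A p.2 (tangentSnd I₁ I₂ p v)) := by
  rw [← (h X A p hX hA v).1, ← (h X A p hX hA v).2, tangentInl_add_tangentInr]

theorem apply_prodVectorField (h : IsProductConnection nabla nabla₁ nabla₂)
    (hX : MDiffAt (T% X) p.1) (hA : MDiffAt (T% A) p.2)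
    (Y : Π x : M₁, TangentSpace I₁ x) (B : Π x : M₂, TangentSpace I₂ x) :
    nabla (prodVectorField X A) p (prodVectorField Y B p) =
      prodVectorField (fun x ↦ nabla₁ X x (Y x)) (fun x ↦ nabla₂ A x (B x)) p := by
  rw [h.apply hX hA, tangentFst_apply, tangentSnd_apply]
  exact (prodVectorField_apply (I₁ := I₁) (I₂ := I₂) (p := p) (fun x ↦ nabla₁ X x (Y x))
    (fun x ↦ nabla₂ A x (B x))).symm

theorem connectionCurvature_prodVectorField [CompleteSpace E₁] [CompleteSpace E₂]
    (h : IsProductConnection nabla nabla₁ nabla₂)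
    (h₁ : CovariantDerivative.ContMDiffCovariantDerivative nabla₁ ∞)
    (h₂ : CovariantDerivative.ContMDiffCovariantDerivative nabla₂ ∞)
    (hX : CMDiff ∞ (T% X)) (hY : CMDiff ∞ (T% Y)) (hZ : CMDiff ∞ (T% Z))
    (hA : CMDiff ∞ (T% A)) (hB : CMDiff ∞ (T% B)) (hC : CMDiff ∞ (T% C)) :
    connectionCurvature nabla (prodVectorField X A) (prodVectorField Y B) (prodVectorField Z C) p =
      prodVectorField (connectionCurvature nabla₁ X Y Z) (connectionCurvature nabla₂ A B C) p := by
  have hX' := hX.mdifferentiable (by simp)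
  have hY' := hY.mdifferentiable (by simp)
  have hZ' := hZ.mdifferentiable (by simp)
  have hA' := hA.mdifferentiable (by simp)
  have hB' := hB.mdifferentiable (by simp)
  have hC' := hC.mdifferentiable (by simp)
  have e (U : Π x : M₁, TangentSpace I₁ x) (D : Π x : M₂, TangentSpace I₂ x) :
      (fun q ↦ nabla (prodVectorField Z C) q (prodVectorField U D q)) =
        prodVectorField (fun x ↦ nabla₁ Z x (U x)) (fun x ↦ nabla₂ C x (D x)) := by
    ext q
    exact h.apply_prodVectorField (hZ' _) (hC' _) U D
  rw [connectionCurvature, e, e, mlieBracket_prodVectorField (hX' _) (hY' _) (hA' _) (hB' _),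
    h.apply_prodVectorField
      ((CovariantDerivative.contMDiff_apply h₁ hY hZ).mdifferentiable (by simp) _)
      ((CovariantDerivative.contMDiff_apply h₂ hB hC).mdifferentiable (by simp) _),
    h.apply_prodVectorField
      ((CovariantDerivative.contMDiff_apply h₁ hX hZ).mdifferentiable (by simp) _)
      ((CovariantDerivative.contMDiff_apply h₂ hA hC).mdifferentiable (by simp) _),
    h.apply_prodVectorField (hZ' _) (hC' _)]
  rfl

theorem isFlatConnection [CompleteSpace E₁] [CompleteSpace E₂] [Nonempty M₁] [Nonempty M₂]
    (h : IsProductConnection nabla nabla₁ nabla₂)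
    (h₁ : CovariantDerivative.ContMDiffCovariantDerivative nabla₁ ∞)
    (h₂ : CovariantDerivative.ContMDiffCovariantDerivative nabla₂ ∞)
    (hflat : IsFlatConnection nabla) : IsFlatConnection nabla₁ ∧ IsFlatConnection nabla₂ := by
  have z₁ : CMDiff ∞ (T% (0 : Π x : M₁, TangentSpace I₁ x)) := contMDiff_zero_vectorField
  have z₂ : CMDiff ∞ (T% (0 : Π x : M₂, TangentSpace I₂ x)) := contMDiff_zero_vectorField
  refine ⟨fun X Y Z hX hY hZ x ↦ ?_, fun A B C hA hB hC y ↦ ?_⟩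
  · obtain ⟨y⟩ := ‹Nonempty M₂›
    have hR := hflat _ _ _ (hX.prodVectorField z₂) (hY.prodVectorField z₂)
      (hZ.prodVectorField z₂) (x, y)
    rw [h.connectionCurvature_prodVectorField h₁ h₂ hX hY hZ z₂ z₂ z₂] at hR
    exact congrArg Prod.fst (show (_ : E₁ × E₂) = 0 from hR)
  · obtain ⟨x⟩ := ‹Nonempty M₁›
    have hR := hflat _ _ _ (z₁.prodVectorField hA) (z₁.prodVectorField hB)
      (z₁.prodVectorField hC) (x, y)
    rw [h.connectionCurvature_prodVectorField h₁ h₂ z₁ z₁ z₁ hA hB hC] at hR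
    exact congrArg Prod.snd (show (_ : E₁ × E₂) = 0 from hR)

variable [FiniteDimensional ℝ E₁] [FiniteDimensional ℝ E₂]

theorem torsion_apply (h : IsProductConnection nabla nabla₁ nabla₂)
    (v w : TangentSpace (I₁.prod I₂) p) :
    nabla.torsion p v w =
      tangentInl I₁ I₂ p (nabla₁.torsion p.1 (tangentFst I₁ I₂ p v) (tangentFst I₁ I₂ p w)) +
      tangentInr I₁ I₂ p (nabla₂.torsion p.2 (tangentSnd I₁ I₂ p v) (tangentSnd I₁ I₂ p w)) := by
  have : CompleteSpace E₁ := FiniteDimensional.complete ℝ E₁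
  have : CompleteSpace E₂ := FiniteDimensional.complete ℝ E₂
  obtain ⟨X, A, hX, hA, rfl⟩ := exists_prodVectorField_eq v
  obtain ⟨Y, B, hY, hB, rfl⟩ := exists_prodVectorField_eq w
  rw [nabla.torsion_apply (hX.prodVectorField hA) (hY.prodVectorField hB),
    h.apply_prodVectorField hX hA, h.apply_prodVectorField hY hB,
    mlieBracket_prodVectorField hX hY hA hB]
  have e₁ := nabla₁.torsion_apply hX hY
  have e₂ := nabla₂.torsion_apply hA hB
  rw [tangentFst_apply, tangentFst_apply, tangentSnd_apply, tangentSnd_apply]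
  refine Eq.trans ?_ (congrArg₂ (fun a b ↦ tangentInl I₁ I₂ p a + tangentInr I₁ I₂ p b) e₁ e₂).symm
  simp only [map_sub, prodVectorField_apply]
  abel

theorem tangentFst_torsion_tangentInl (h : IsProductConnection nabla nabla₁ nabla₂)
    (u v : TangentSpace I₁ p.1) :
    tangentFst I₁ I₂ p (nabla.torsion p (tangentInl I₁ I₂ p u) (tangentInl I₁ I₂ p v)) =
      nabla₁.torsion p.1 u v := by
  rw [h.torsion_apply, map_add]
  simp only [tangentFst_tangentInl, tangentFst_tangentInr, add_zero]

theorem tangentSnd_torsion_tangentInr (h : IsProductConnection nabla nabla₁ nabla₂)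
    (u v : TangentSpace I₂ p.2) :
    tangentSnd I₁ I₂ p (nabla.torsion p (tangentInr I₁ I₂ p u) (tangentInr I₁ I₂ p v)) =
      nabla₂.torsion p.2 u v := by
  rw [h.torsion_apply, map_add]
  simp only [tangentSnd_tangentInl, tangentSnd_tangentInr, zero_add]

variable [RiemannianBundle (fun x : M₁ ↦ TangentSpace I₁ x)]
  [RiemannianBundle (fun x : M₂ ↦ TangentSpace I₂ x)]
  [RiemannianBundle (fun p : M₁ × M₂ ↦ TangentSpace (I₁.prod I₂) p)]
  {T : ThreeForm (I₁.prod I₂) (M₁ × M₂)}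

theorem isSum_of_hasTorsionForm (h : IsProductConnection nabla nabla₁ nabla₂)
    (hprod : IsRiemannianProduct I₁ M₁ I₂ M₂) (hT : HasTorsionForm nabla T)
    {T₁ : ThreeForm I₁ M₁} {T₂ : ThreeForm I₂ M₂} (hT₁ : HasTorsionForm nabla₁ T₁)
    (hT₂ : HasTorsionForm nabla₂ T₂) : T.IsSum T₁ T₂ := by
  intro p
  ext v
  have e := hT p (v 0) (v 1) (v 2)
  rw [h.torsion_apply, inner_add_left, real_inner_comm, hprod.inner_tangentInl,
    real_inner_comm (v 2) (tangentInr _ _ _ _), hprod.inner_tangentInr,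
    real_inner_comm, ← hT₁, real_inner_comm, ← hT₂] at e
  have hv {α : Type _} (f : Fin 3 → α) : f = ![f 0, f 1, f 2] := by
    ext i
    fin_cases i <;> rfl
  rw [hv v, e]
  refine congrArg₂ (· + ·) (congrArg (T₁.toFun p.1) ?_) (congrArg (T₂.toFun p.2) ?_)
  · ext i
    fin_cases i <;> rfl
  · ext i
    fin_cases i <;> rfl

theorem hasTorsionForm_sliceFst (h : IsProductConnection nabla nabla₁ nabla₂)
    (hprod : IsRiemannianProduct I₁ M₁ I₂ M₂) (hT : HasTorsionForm nabla T) (y : M₂) :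
    HasTorsionForm nabla₁ (T.sliceFst y) := by
  intro x u v w
  have e := hT (x, y) (tangentInl I₁ I₂ (x, y) u) (tangentInl I₁ I₂ (x, y) v)
    (tangentInl I₁ I₂ (x, y) w)
  rw [hprod.inner_tangentInl] at e
  replace e := e.trans (congrArg (fun t ↦ inner ℝ t w)
    (h.tangentFst_torsion_tangentInl (p := (x, y)) u v))
  refine Eq.trans (congrArg (T.toFun (x, y)) ?_) e
  ext i
  fin_cases i <;> rfl

theorem hasTorsionForm_sliceSnd (h : IsProductConnection nabla nabla₁ nabla₂)
    (hprod : IsRiemannianProduct I₁ M₁ I₂ M₂) (hT : HasTorsionForm nabla T) (x : M₁) :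
    HasTorsionForm nabla₂ (T.sliceSnd x) := by
  intro y u v w
  have e := hT (x, y) (tangentInr I₁ I₂ (x, y) u) (tangentInr I₁ I₂ (x, y) v)
    (tangentInr I₁ I₂ (x, y) w)
  rw [hprod.inner_tangentInr] at e
  replace e := e.trans (congrArg (fun t ↦ inner ℝ t w)
    (h.tangentSnd_torsion_tangentInr (p := (x, y)) u v))
  refine Eq.trans (congrArg (T.toFun (x, y)) ?_) e
  ext i
  fin_cases i <;> rfl

variable [IsContMDiffRiemannianBundle I₁ ∞ E₁ (fun x : M₁ ↦ TangentSpace I₁ x)]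
  [IsContMDiffRiemannianBundle I₂ ∞ E₂ (fun x : M₂ ↦ TangentSpace I₂ x)]
  [IsContMDiffRiemannianBundle (I₁.prod I₂) ∞ (E₁ × E₂)
    (fun p : M₁ × M₂ ↦ TangentSpace (I₁.prod I₂) p)]

theorem isMetricCompatible [Nonempty M₁] [Nonempty M₂]
    (h : IsProductConnection nabla nabla₁ nabla₂)
    (hprod : IsRiemannianProduct I₁ M₁ I₂ M₂)
    (hg : CovariantDerivative.IsMetricCompatible
      (V := fun p : M₁ × M₂ ↦ TangentSpace (I₁.prod I₂) p) nabla) :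
    CovariantDerivative.IsMetricCompatible (V := fun x : M₁ ↦ TangentSpace I₁ x) nabla₁ ∧
      CovariantDerivative.IsMetricCompatible (V := fun x : M₂ ↦ TangentSpace I₂ x) nabla₂ := by
  constructor
  · refine CovariantDerivative.isMetricCompatible_of_apply fun x X Y Z hY hZ ↦ ?_
    obtain ⟨y⟩ := ‹Nonempty M₂›
    have z : MDiffAt (T% (0 : Π x : M₂, TangentSpace I₂ x)) y := mdifferentiableAt_zero_vectorField
    have hm := hg.mvfderiv_inner_apply (x := (x, y)) (MDifferentiableAt.prodVectorField hY z)
      (MDifferentiableAt.prodVectorField hZ z) (prodVectorField X 0 (x, y))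
    rw [hprod.mvfderiv_inner (p := (x, y)) hY hZ z z,
      h.apply_prodVectorField (p := (x, y)) hY z, h.apply_prodVectorField (p := (x, y)) hZ z,
      hprod.inner_prodVectorField, hprod.inner_prodVectorField, tangentFst_apply,
      tangentSnd_apply] at hm
    simpa [prodVectorField] using! hm
  · refine CovariantDerivative.isMetricCompatible_of_apply fun y A B C hB hC ↦ ?_
    obtain ⟨x⟩ := ‹Nonempty M₁›
    have z : MDiffAt (T% (0 : Π x : M₁, TangentSpace I₁ x)) x := mdifferentiableAt_zero_vectorField
    have hm := hg.mvfderiv_inner_apply (x := (x, y)) (MDifferentiableAt.prodVectorField z hB)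
      (MDifferentiableAt.prodVectorField z hC) (prodVectorField 0 A (x, y))
    rw [hprod.mvfderiv_inner (p := (x, y)) z z hB hC,
      h.apply_prodVectorField (p := (x, y)) z hB, h.apply_prodVectorField (p := (x, y)) z hC,
      hprod.inner_prodVectorField, hprod.inner_prodVectorField, tangentFst_apply,
      tangentSnd_apply] at hm
    simpa [prodVectorField] using! hm

theorem isFlatMetricConnection [Nonempty M₁] [Nonempty M₂]
    (h : IsProductConnection nabla nabla₁ nabla₂)
    (h₁ : CovariantDerivative.ContMDiffCovariantDerivative nabla₁ ∞)
    (h₂ : CovariantDerivative.ContMDiffCovariantDerivative nabla₂ ∞)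
    (hprod : IsRiemannianProduct I₁ M₁ I₂ M₂) (hnabla : IsFlatMetricConnection nabla) :
    IsFlatMetricConnection nabla₁ ∧ IsFlatMetricConnection nabla₂ := by
  have : CompleteSpace E₁ := FiniteDimensional.complete ℝ E₁
  have : CompleteSpace E₂ := FiniteDimensional.complete ℝ E₂
  have hm := h.isMetricCompatible hprod hnabla.metric
  have hf := h.isFlatConnection h₁ h₂ hnabla.flat
  exact ⟨⟨h₁, hm.1, hf.1⟩, ⟨h₂, hm.2, hf.2⟩⟩

end IsProductConnection

end ProductConnection

end SplitConnection

theorem mainTheorem6 {n₁ n₂ : ℕ}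
    {M₁ : Type*} [TopologicalSpace M₁] [T2Space M₁] [SecondCountableTopology M₁]
    [ConnectedSpace M₁] [ChartedSpace (EuclideanSpace ℝ (Fin n₁)) M₁] [IsManifold (𝓡 n₁) ∞ M₁]
    [RiemannianBundle (fun x : M₁ ↦ TangentSpace (𝓡 n₁) x)]
    [IsContMDiffRiemannianBundle (𝓡 n₁) ∞ (EuclideanSpace ℝ (Fin n₁))
      (fun x : M₁ ↦ TangentSpace (𝓡 n₁) x)]
    {M₂ : Type*} [TopologicalSpace M₂] [T2Space M₂] [SecondCountableTopology M₂]
    [ConnectedSpace M₂] [ChartedSpace (EuclideanSpace ℝ (Fin n₂)) M₂] [IsManifold (𝓡 n₂) ∞ M₂]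
    [RiemannianBundle (fun x : M₂ ↦ TangentSpace (𝓡 n₂) x)]
    [IsContMDiffRiemannianBundle (𝓡 n₂) ∞ (EuclideanSpace ℝ (Fin n₂))
      (fun x : M₂ ↦ TangentSpace (𝓡 n₂) x)]
    [RiemannianBundle (fun p : M₁ × M₂ ↦ TangentSpace ((𝓡 n₁).prod (𝓡 n₂)) p)]
    [IsContMDiffRiemannianBundle ((𝓡 n₁).prod (𝓡 n₂)) ∞
      (EuclideanSpace ℝ (Fin n₁) × EuclideanSpace ℝ (Fin n₂))
      (fun p : M₁ × M₂ ↦ TangentSpace ((𝓡 n₁).prod (𝓡 n₂)) p)]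
    (hprod : IsRiemannianProduct (𝓡 n₁) M₁ (𝓡 n₂) M₂)
    (nabla : CovariantDerivative ((𝓡 n₁).prod (𝓡 n₂))
      (EuclideanSpace ℝ (Fin n₁) × EuclideanSpace ℝ (Fin n₂))
      (TangentSpace ((𝓡 n₁).prod (𝓡 n₂)) : M₁ × M₂ → Type _))
    (hnabla : IsFlatMetricConnection nabla)
    (T : ThreeForm ((𝓡 n₁).prod (𝓡 n₂)) (M₁ × M₂))
    (hT : HasTorsionForm nabla T) :
    ∃ (T₁ : ThreeForm (𝓡 n₁) M₁) (T₂ : ThreeForm (𝓡 n₂) M₂)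
      (nabla₁ : CovariantDerivative (𝓡 n₁) (EuclideanSpace ℝ (Fin n₁))
        (TangentSpace (𝓡 n₁) : M₁ → Type _))
      (nabla₂ : CovariantDerivative (𝓡 n₂) (EuclideanSpace ℝ (Fin n₂))
        (TangentSpace (𝓡 n₂) : M₂ → Type _)),
      T.IsSum T₁ T₂ ∧
      IsProductConnection nabla nabla₁ nabla₂ ∧
      IsFlatMetricConnection nabla₁ ∧ HasTorsionForm nabla₁ T₁ ∧
      IsFlatMetricConnection nabla₂ ∧ HasTorsionForm nabla₂ T₂ := by
  obtain ⟨x₀⟩ : Nonempty M₁ := inferInstance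
  obtain ⟨y₀⟩ : Nonempty M₂ := inferInstance
  have hP := isProductConnection_slice hprod hnabla hT (x₀, y₀)
  have hF := hP.isFlatMetricConnection (contMDiff_sliceFst hnabla.smooth y₀)
    (contMDiff_sliceSnd hnabla.smooth x₀) hprod hnabla
  have h₁ := hP.hasTorsionForm_sliceFst hprod hT y₀
  have h₂ := hP.hasTorsionForm_sliceSnd hprod hT x₀
  exact ⟨_, _, _, _, hP.isSum_of_hasTorsionForm hprod hT h₁ h₂, hP, hF.1, h₁, hF.2, h₂⟩
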